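/- Let $R$ be a commutative $\mathbb C$-algebra with derivations $\partial_{t_p^{(a)}}$ ($a=1,2$, $p\ge1$) (for example Laurent series in the times $t$ with the partial derivatives), let $\mathcal A$ be the ring of functions $\mathbb Z\to R$, $n\mapsto f(n)$, let $\Lambda f(n)=f(n+1)$, $\Delta=\Lambda-1$, $\Delta^*=\Lambda^{-1}-1$, $\iota_{\Lambda^{-1}}\Delta^{-1}=\sum_{j\ge1}\Lambda^{-j}$, $\iota_\Lambda\Delta^{-1}=-\sum_{j\ge0}\Lambda^j$, and $(\sum f_j\Lambda^j)^*=\sum\Lambda^{-j}f_j$. Subscripts $\ge0$, $<0$ denote truncations in powers of $\Lambda$, and $(\cdot)_{\Delta,\ge1}$, $(\cdot)_{\Delta^*,\ge1}$ truncations in powers of $\Delta$, $\Delta^*$. Derivations act on operators coefficientwise; we write $A(f)$ for the action of an operator $A$ on a function $f$. Let $M,N\ge1$, $m\ge0$, and let $L_1=u_{-1}\Lambda+\sum_{j\ge0}u_j\Lambda^{-j}$, $L_2=\bar u_{-1}\Lambda^{-1}+\sum_{j\ge0}\bar u_j\Lambda^j$ ($u_{-1},\bar u_{-1}$ invertible)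 and $q_i,r_i\in\mathcal A$ ($1\le i\le m$) solve the generalized bigraded modified Toda (GBMT) hierarchy: $$L_1^M\,\iota_{\Lambda^{-1}}\Delta^{-1}=L_2^N\,\iota_{\Lambda}\Delta^{-1}+\sum_{l\in\mathbb Z}\sum_{i=1}^m q_{i,n}\Lambda^l r_{i,n+1},$$ $$\partial_{t_p^{(a)}}L_b=[B_p^{(a)},L_b],\qquad \partial_{t_p^{(a)}}q_i=B_p^{(a)}(q_i),\qquad \partial_{t_p^{(a)}}r_i=-(\Delta^{-1}B_p^{(a)*}\Delta)(r_i),$$ where $B_p^{(1)}=(L_1^p)_{\Delta,\ge1}$, $B_p^{(2)}=(L_2^p)_{\Delta^*,\ge1}$. Let $S_1=\sum_{j\ge0}s_j\Lambda^{-j}$ with $s_0=c_0$ invertible be a wave operator of $L_1$: $L_1=S_1\Lambda S_1^{-1}$, $\partial_{t_p^{(1)}}S_1=B_p^{(1)}S_1-S_1\Lambda^p$, $\partial_{t_p^{(2)}}S_1=B_p^{(2)}S_1$. Put $T_1=c_0^{-1}(n)$, $T_2=c_0^{-1}(n+1)\Delta$ and $$\mathcal L_a=T_1L_aT_1^{-1},\qquad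 \mathcal L_1'=T_2L_1\,\iota_{\Lambda^{-1}}T_2^{-1},\qquad \mathcal L_2'=T_2L_2\,\iota_{\Lambda}T_2^{-1},$$ where $\iota_{\Lambda^{\pm1}}T_2^{-1}=\iota_{\Lambda^{\pm1}}\Delta^{-1}\,c_0(n+1)$. Then $(\mathcal L_1,\mathcal L_2)$ and $(\mathcal L_1',\mathcal L_2')$ are Lax operators of the generalized bigraded Toda (GBT) hierarchy. That is, each pair $(\tilde{\mathcal L}_1,\tilde{\mathcal L}_2)$ of the two has the form $\tilde{\mathcal L}_1=\Lambda+\sum_{j\ge0}a_j\Lambda^{-j}$, $\tilde{\mathcal L}_2=b\Lambda^{-1}+\sum_{j\ge0}b_j\Lambda^j$ with $b$ invertible, it satisfies the Toda Lax equations $\partial_{t_p^{(a)}}\tilde{\mathcal L}_b=[\tilde{\mathcal B}_p^{(a)},\tilde{\mathcal L}_b]$ with $\tilde{\mathcal B}_p^{(1)}=(\tilde{\mathcal L}_1^p)_{\ge0}$, $\tilde{\mathcal B}_p^{(2)}=(\tilde{\mathcal L}_2^p)_{<0}$, and $$\mathcal L_1^M=\mathcal L_2^N+\sum_{l\in\mathbb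 Z}\sum_{i=1}^m\tilde q_{i,n}\Lambda^l\tilde r_{i,n},\qquad \mathcal L_1'^M=\mathcal L_2'^N+\sum_{l\in\mathbb Z}\sum_{i=1}^m\tilde q'_{i,n}\Lambda^l\tilde r'_{i,n+1},$$ where $$\tilde q_{i,n}=c_0^{-1}(n)q_{i,n},\quad \tilde r_{i,n}=-c_0(n)\Delta(r_{i,n}),\qquad \tilde q'_{i,n}=c_0^{-1}(n+1)\Delta(q_{i,n}),\quad \tilde r'_{i,n+1}=c_0(n+1)r_{i,n+1}.$$ Moreover $\tilde q_{i,n},\tilde q'_{i,n}$ are Toda eigenfunctions, $\partial_{t_p^{(a)}}\tilde q=\tilde{\mathcal B}_p^{(a)}(\tilde q)$, and $\tilde r_{i,n},\tilde r'_{i,n+1}$ (as functions of $n$) are Toda adjoint eigenfunctions, $\partial_{t_p^{(a)}}\tilde r=-\tilde{\mathcal B}_p^{(a)*}(\tilde r)$, of the corresponding pair. -/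

import Mathlib

namespace MiuraToda

/-- Two-sided formal difference operators `∑_j a_j Λ^j`, `j ∈ ℤ`, whose coefficients are functions
`a_j : ℤ → R` of the lattice variable `n`; `A j n` is the value at `n` of the coefficient of `Λ^j`.
The operators with `A j = 0` for all large `j` form the ring `𝒜[[Λ⁻¹]][Λ]`, those with `A j = 0` for
all very negative `j` form the ring `𝒜[[Λ]][Λ⁻¹]`, where `𝒜` is the ring of functions `ℤ → R`. -/
def FormalOp (R : Type*) : Type _ := ℤ → ℤ → R

namespace FormalOp

@[ext] theorem ext {R : Type*} {A B : FormalOp R} (h : ∀ j n, A j n = B j n) : A = B :=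
  funext fun j => funext fun n => h j n

variable {R : Type*} [CommRing R]

instance : AddCommGroup (FormalOp R) := inferInstanceAs (AddCommGroup (ℤ → ℤ → R))

/-- Multiplication by the function `f`, an operator of order zero. -/
def mulOp (f : ℤ → R) : FormalOp R := fun j n => if j = 0 then f n else 0

instance : One (FormalOp R) := ⟨mulOp 1⟩

/-- Composition, from `a Λ^i · b Λ^k = a(n) b(n+i) Λ^(i+k)`. The sum is finite for two operators of
`𝒜[[Λ⁻¹]][Λ]`, for two operators of `𝒜[[Λ]][Λ⁻¹]`, and whenever one factor is a Laurent polynomial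
in `Λ`. -/
noncomputable instance : Mul (FormalOp R) :=
  ⟨fun A B j n => ∑ᶠ i : ℤ, A i n * B (j - i) (n + i)⟩

/-- Powers: `A ^ 0 = 1` and `A ^ (k + 1) = A ^ k * A`. -/
noncomputable instance : Pow (FormalOp R) ℕ := ⟨fun A k => npowRec k A⟩

/-- The shift operator `Λ`. -/
def shift : FormalOp R := fun j _ => if j = 1 then 1 else 0

/-- The difference operator `Δ = Λ - 1`. -/
def delta : FormalOp R := shift - 1

/-- `ι_{Λ⁻¹} Δ⁻¹ = ∑_{i ≥ 1} Λ^{-i}`. -/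
def deltaInvMinus : FormalOp R := fun j _ => if j ≤ -1 then 1 else 0

/-- `ι_Λ Δ⁻¹ = - ∑_{i ≥ 0} Λ^i`. -/
def deltaInvPlus : FormalOp R := fun j _ => if 0 ≤ j then -1 else 0

/-- The formal adjoint `(∑ a_j Λ^j)^* = ∑ Λ^{-j} a_j`. -/
def adj (A : FormalOp R) : FormalOp R := fun j n => A (-j) (n + j)

/-- The action `A(f) = ∑_j a_j Λ^j(f)` on a function (used for Laurent polynomials in `Λ`). -/
noncomputable def act (A : FormalOp R) (f : ℤ → R) : ℤ → R := fun n => ∑ᶠ j : ℤ, A j n * f (n + j)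

/-- The two-sided operator `∑_{l ∈ ℤ} q Λ^l r`, where `q Λ^l r = q(n) r(n+l) Λ^l`. -/
def bilateral (q r : ℤ → R) : FormalOp R := fun l n => q n * r (n + l)

/-- The part of `A` made of the powers `Λ^j` with `P j`. -/
def trunc (P : ℤ → Prop) [DecidablePred P] (A : FormalOp R) : FormalOp R :=
  fun j n => if P j then A j n else 0

/-- For `A` in `𝒜[[Λ⁻¹]][Λ]`, the part `A_{Δ,≥1}` made of the powers `Δ^j`, `j ≥ 1`, in the
expansion of `A` in powers of `Δ`. Negative powers of `Λ` expand into negative powers of `Δ`, and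
`Λ^k - 1` is the part of `Λ^k = (1 + Δ)^k` with positive powers; so the result is
`A_{≥1} - A_{≥1}(1)`. See `deltaTrunc_apply` for the expansion itself. -/
noncomputable def deltaTrunc (A : FormalOp R) : FormalOp R :=
  trunc (1 ≤ ·) A - mulOp ((trunc (1 ≤ ·) A).act 1)

/-- For `A` in `𝒜[[Λ]][Λ⁻¹]`, the part `A_{Δ^*,≥1}` made of the powers `(Δ^*)^j`, `j ≥ 1`, in the
expansion of `A` in powers of `Δ^* = Λ⁻¹ - 1`; it is `A_{<0} - A_{<0}(1)`.
See `deltaStarTrunc_apply` for the expansion itself. -/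
noncomputable def deltaStarTrunc (A : FormalOp R) : FormalOp R :=
  trunc (· < 0) A - mulOp ((trunc (· < 0) A).act 1)

/-- A derivation of the coefficient ring applied to every coefficient. -/
def derivOp {K : Type*} [CommRing K] [Algebra K R] (D : Derivation K R R) (A : FormalOp R) :
    FormalOp R := fun j n => D (A j n)

end FormalOp

open FormalOp

/-- `Λ(f) = f(n+1)`. -/
def shiftFun {R : Type*} (f : ℤ → R) : ℤ → R := fun n => f (n + 1)

/-- `Δ(f) = f(n+1) - f(n)`. -/
def deltaFun {R : Type*} [CommRing R] (f : ℤ → R) : ℤ → R := fun n => f (n + 1) - f n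

section Hierarchies

variable {R : Type*} [CommRing R] [Algebra ℂ R]

/-- `B_p^{(1)} = (L₁^p)_{Δ,≥1}` (index `0`) and `B_p^{(2)} = (L₂^p)_{Δ^*,≥1}` (index `1`). -/
noncomputable def mTodaB (L₁ L₂ : FormalOp R) (a : Fin 2) (p : ℕ) : FormalOp R :=
  if a = 0 then deltaTrunc (L₁ ^ p) else deltaStarTrunc (L₂ ^ p)

/-- `𝓑_p^{(1)} = (𝓛₁^p)_{≥0}` (index `0`) and `𝓑_p^{(2)} = (𝓛₂^p)_{<0}` (index `1`). -/
noncomputable def todaB (L₁ L₂ : FormalOp R) (a : Fin 2) (p : ℕ) : FormalOp R :=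
  if a = 0 then trunc (0 ≤ ·) (L₁ ^ p) else trunc (· < 0) (L₂ ^ p)

/-- The generalized bigraded modified Toda (GBMT) hierarchy in Lax form. `D a p` is the derivation
`∂/∂t_p^{(a+1)}`, `p ≥ 1`. -/
structure IsGBMT (D : Fin 2 → ℕ → Derivation ℂ R R) (M N : ℕ) {m : ℕ} (L₁ L₂ : FormalOp R)
    (q r : Fin m → ℤ → R) : Prop where
  /-- `L₁ = u₋₁ Λ + ∑_{j ≥ 0} u_j Λ^{-j}` -/
  shape₁ : ∀ j, 1 < j → ∀ n, L₁ j n = 0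
  lead₁ : ∀ n, IsUnit (L₁ 1 n)
  /-- `L₂ = ū₋₁ Λ⁻¹ + ∑_{j ≥ 0} ū_j Λ^j` -/
  shape₂ : ∀ j, j < -1 → ∀ n, L₂ j n = 0
  lead₂ : ∀ n, IsUnit (L₂ (-1) n)
  /-- `L₁^M ι_{Λ⁻¹}Δ⁻¹ = L₂^N ι_Λ Δ⁻¹ + ∑_l ∑_i q_{i,n} Λ^l r_{i,n+1}` -/
  constraint : L₁ ^ M * deltaInvMinus =
    L₂ ^ N * deltaInvPlus + ∑ i, bilateral (q i) (shiftFun (r i))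
  lax₁ : ∀ a p, 1 ≤ p →
    derivOp (D a p) L₁ = mTodaB L₁ L₂ a p * L₁ - L₁ * mTodaB L₁ L₂ a p
  lax₂ : ∀ a p, 1 ≤ p →
    derivOp (D a p) L₂ = mTodaB L₁ L₂ a p * L₂ - L₂ * mTodaB L₁ L₂ a p
  /-- `q_i` is an eigenfunction: `∂q = B(q)` -/
  eigen : ∀ i a p, 1 ≤ p → ∀ n, D a p (q i n) = (mTodaB L₁ L₂ a p).act (q i) n
  /-- `r_i` is an adjoint eigenfunction: `∂r = -(Δ⁻¹ B^* Δ)(r)`. As `B(1) = 0`, the operator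
  `Δ⁻¹ B^*` is a Laurent polynomial in `Λ`, the same for both expansions of `Δ⁻¹`. -/
  adjEigen : ∀ i a p, 1 ≤ p → ∀ n,
    D a p (r i n) = -((deltaInvMinus * (mTodaB L₁ L₂ a p).adj * delta).act (r i) n)

/-- `S = ∑_{j ≥ 0} s_j Λ^{-j}`, with `s_0 = c₀` invertible, is a wave operator of the modified Toda
Lax operator `L₁`: `L₁ = S Λ S⁻¹`, and `S` satisfies the evolution equations of the hierarchy. -/
structure IsWaveOp (D : Fin 2 → ℕ → Derivation ℂ R R) (L₁ L₂ S : FormalOp R) (c₀ : ℤ → Rˣ) :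
    Prop where
  shape : ∀ j, 0 < j → ∀ n, S j n = 0
  lead : ∀ n, S 0 n = c₀ n
  dressing : ∃ S' : FormalOp R, (∀ j, 0 < j → ∀ n, S' j n = 0) ∧ S * S' = 1 ∧ S' * S = 1 ∧
    L₁ = S * shift * S'
  evol₁ : ∀ p, 1 ≤ p → derivOp (D 0 p) S = mTodaB L₁ L₂ 0 p * S - S * shift ^ p
  evol₂ : ∀ p, 1 ≤ p → derivOp (D 1 p) S = mTodaB L₁ L₂ 1 p * S

/-- The generalized bigraded Toda (GBT) hierarchy in Lax form, with Toda eigenfunctions `q_i` and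
Toda adjoint eigenfunctions `r_i`. -/
structure IsGBT (D : Fin 2 → ℕ → Derivation ℂ R R) (M N : ℕ) {m : ℕ} (L₁ L₂ : FormalOp R)
    (q r : Fin m → ℤ → R) : Prop where
  /-- `L₁ = Λ + ∑_{j ≥ 0} a_j Λ^{-j}` -/
  shape₁ : ∀ j, 1 < j → ∀ n, L₁ j n = 0
  lead₁ : ∀ n, L₁ 1 n = 1
  /-- `L₂ = b Λ⁻¹ + ∑_{j ≥ 0} b_j Λ^j` -/
  shape₂ : ∀ j, j < -1 → ∀ n, L₂ j n = 0
  lead₂ : ∀ n, IsUnit (L₂ (-1) n)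
  /-- `L₁^M = L₂^N + ∑_l ∑_i q_i Λ^l r_i` -/
  constraint : L₁ ^ M = L₂ ^ N + ∑ i, bilateral (q i) (r i)
  lax₁ : ∀ a p, 1 ≤ p → derivOp (D a p) L₁ = todaB L₁ L₂ a p * L₁ - L₁ * todaB L₁ L₂ a p
  lax₂ : ∀ a p, 1 ≤ p → derivOp (D a p) L₂ = todaB L₁ L₂ a p * L₂ - L₂ * todaB L₁ L₂ a p
  /-- `∂q = 𝓑(q)` -/
  eigen : ∀ i a p, 1 ≤ p → ∀ n, D a p (q i n) = (todaB L₁ L₂ a p).act (q i) n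
  /-- `∂r = -𝓑^*(r)` -/
  adjEigen : ∀ i a p, 1 ≤ p → ∀ n, D a p (r i n) = -((todaB L₁ L₂ a p).adj.act (r i) n)

end Hierarchies

section Miura

variable {R : Type*} [CommRing R]

/-- The function `c₀`. -/
def cFun (c₀ : ℤ → Rˣ) : ℤ → R := fun n => (c₀ n : R)

/-- The function `c₀⁻¹`. -/
def cInvFun (c₀ : ℤ → Rˣ) : ℤ → R := fun n => ((c₀ n)⁻¹ : Rˣ)

/-- `T₁ = c₀⁻¹(n)`. -/
def T₁ (c₀ : ℤ → Rˣ) : FormalOp R := mulOp (cInvFun c₀)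

/-- `T₁⁻¹ = c₀(n)`. -/
def T₁Inv (c₀ : ℤ → Rˣ) : FormalOp R := mulOp (cFun c₀)

/-- `T₂ = c₀⁻¹(n+1) Δ`. -/
noncomputable def T₂ (c₀ : ℤ → Rˣ) : FormalOp R := mulOp (shiftFun (cInvFun c₀)) * delta

/-- `ι_{Λ⁻¹} T₂⁻¹ = ι_{Λ⁻¹}Δ⁻¹ c₀(n+1)`. -/
noncomputable def T₂InvMinus (c₀ : ℤ → Rˣ) : FormalOp R := deltaInvMinus * mulOp (shiftFun (cFun c₀))

/-- `ι_Λ T₂⁻¹ = ι_ΛΔ⁻¹ c₀(n+1)`. -/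
noncomputable def T₂InvPlus (c₀ : ℤ → Rˣ) : FormalOp R := deltaInvPlus * mulOp (shiftFun (cFun c₀))

end Miura

/-! Checks of the definitions: the truncations agree with the expansions in `Δ` and `Δ^*`. -/

namespace FormalOp

variable {R : Type*} [CommRing R]

theorem mul_apply (A B : FormalOp R) (j n : ℤ) :
    (A * B) j n = ∑ᶠ i : ℤ, A i n * B (j - i) (n + i) := rfl

theorem mul_delta_apply (A : FormalOp R) (j n : ℤ) : (A * delta : FormalOp R) j n = A (j - 1) n - A j n := by
  have h1 : (fun i : ℤ => A i n * (delta : FormalOp R) (j - i) (n + i)) =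
      fun i => (if i = j - 1 then A i n else 0) + (if i = j then -A i n else 0) := by
    funext i
    change A i n * ((if j - i = 1 then 1 else 0) - (if j - i = 0 then 1 else 0)) = _
    split_ifs <;> first | omega | simp
  rw [mul_apply, h1, finsum_eq_sum_of_support_subset (s := {j - 1, j})]
  · rw [Finset.sum_pair (by omega)]
    simp [sub_eq_add_neg]
  · intro i hi
    by_contra hc
    simp at hc
    simp [hc] at hi

theorem mul_deltaStar_apply (A : FormalOp R) (j n : ℤ) :
    (A * delta.adj : FormalOp R) j n = A (j + 1) n - A j n := by
  have h1 : (fun i : ℤ => A i n * (delta.adj : FormalOp R) (j - i) (n + i)) =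
      fun i => (if i = j + 1 then A i n else 0) + (if i = j then -A i n else 0) := by
    funext i
    change A i n * ((if -(j - i) = 1 then 1 else 0) - (if -(j - i) = 0 then 1 else 0)) = _
    split_ifs <;> first | omega | simp
  rw [mul_apply, h1, finsum_eq_sum_of_support_subset (s := {j + 1, j})]
  · rw [Finset.sum_pair (by omega)]
    simp [sub_eq_add_neg]
  · intro i hi
    by_contra hc
    simp at hc
    simp [hc] at hi

theorem coeff_shift_delta (P : Polynomial R) (l : ℤ) :
    (if 0 ≤ l then (P * (Polynomial.X - 1)).coeff l.toNat else 0) =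
      (if 0 ≤ l - 1 then P.coeff (l - 1).toNat else 0) -
        (if 0 ≤ l then P.coeff l.toNat else 0) := by
  rw [mul_sub, mul_one, Polynomial.coeff_sub]
  rcases lt_trichotomy l 0 with h | h | h
  · rw [if_neg (by omega), if_neg (by omega), if_neg (by omega), sub_zero]
  · subst h
    simp
  · obtain ⟨k, rfl⟩ : ∃ k : ℕ, l = (k : ℤ) + 1 := ⟨(l - 1).toNat, by omega⟩
    have e1 : ((k : ℤ) + 1).toNat = k + 1 := by omega
    have e2 : ((k : ℤ) + 1 - 1).toNat = k := by omega
    rw [if_pos (by omega), if_pos (by omega), if_pos (by omega), e1, e2, Polynomial.coeff_mul_X]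

theorem delta_pow_apply (k : ℕ) (l n : ℤ) : (delta ^ k : FormalOp R) l n =
    if 0 ≤ l then (((Polynomial.X - 1) ^ k : Polynomial R)).coeff l.toNat else 0 := by
  induction k generalizing l with
  | zero =>
    change (if l = 0 then (1 : R) else 0) = _
    rw [_root_.pow_zero, Polynomial.coeff_one]
    split_ifs <;> first | omega | rfl
  | succ k ih =>
    change ((delta ^ k : FormalOp R) * delta : FormalOp R) l n = _
    rw [mul_delta_apply, ih, ih, _root_.pow_succ, coeff_shift_delta]

theorem deltaStar_pow_apply (k : ℕ) (l n : ℤ) : ((delta.adj : FormalOp R) ^ k) l n =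
    if 0 ≤ -l then (((Polynomial.X - 1) ^ k : Polynomial R)).coeff (-l).toNat else 0 := by
  induction k generalizing l with
  | zero =>
    change (if l = 0 then (1 : R) else 0) = _
    rw [_root_.pow_zero, Polynomial.coeff_one]
    split_ifs <;> first | omega | rfl
  | succ k ih =>
    change ((delta.adj : FormalOp R) ^ k * delta.adj : FormalOp R) l n = _
    rw [mul_deltaStar_apply, ih, ih, _root_.pow_succ, coeff_shift_delta,
      show -(l + 1) = -l - 1 by ring]

theorem sum_choose_coeff (K k : ℕ) (hk : k ≤ K) (d : ℕ) :
    ∑ j ∈ Finset.Icc 1 K, (k.choose j : R) * ((Polynomial.X - 1) ^ j : Polynomial R).coeff d =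
      (if d = k then 1 else 0) - (if d = 0 then 1 else 0) := by
  have h := add_pow (Polynomial.X - 1 : Polynomial R) 1 k
  rw [sub_add_cancel] at h
  have h2 : (Polynomial.X ^ k : Polynomial R).coeff d =
      ∑ j ∈ Finset.range (K + 1),
        (k.choose j : R) * ((Polynomial.X - 1) ^ j : Polynomial R).coeff d := by
    rw [h, Polynomial.finsetSum_coeff]
    rw [← Finset.sum_subset (Finset.range_subset_range.2 (Nat.succ_le_succ hk))]
    · refine Finset.sum_congr rfl fun j _ => ?_
      rw [one_pow, mul_one, mul_comm, ← Polynomial.C_eq_natCast, Polynomial.coeff_C_mul]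
    · intro j _ hj
      rw [Finset.mem_range, not_lt] at hj
      rw [Nat.choose_eq_zero_of_lt (by omega), Nat.cast_zero, zero_mul]
  rw [Polynomial.coeff_X_pow, Finset.range_eq_Ico, Finset.sum_eq_sum_Ico_succ_bot (by omega)] at h2
  simp only [Nat.choose_zero_right, Nat.cast_one, one_mul, _root_.pow_zero,
    Polynomial.coeff_one] at h2
  rw [h2, add_sub_cancel_left]
  rfl

theorem sum_choose_aux (K : ℕ) (a : ℕ → R) (d : ℕ) :
    ∑ j ∈ Finset.Icc 1 K, (∑ k ∈ Finset.Icc 1 K, (k.choose j : R) * a k) *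
      ((Polynomial.X - 1) ^ j : Polynomial R).coeff d =
    ∑ k ∈ Finset.Icc 1 K, ((if d = k then a k else 0) - (if d = 0 then a k else 0)) := by
  simp_rw [Finset.sum_mul]
  rw [Finset.sum_comm]
  refine Finset.sum_congr rfl fun k hk => ?_
  have := sum_choose_coeff (R := R) K k (Finset.mem_Icc.1 hk).2 d
  calc _ = a k * ∑ j ∈ Finset.Icc 1 K, (k.choose j : R) *
        ((Polynomial.X - 1) ^ j : Polynomial R).coeff d := by
        rw [Finset.mul_sum]
        exact Finset.sum_congr rfl fun j _ => by ring
    _ = _ := by rw [this]; split_ifs <;> simp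

theorem deltaTrunc_apply (A : FormalOp R) (K : ℕ) (hA : ∀ j, (K : ℤ) < j → ∀ n, A j n = 0)
    (l n : ℤ) :
    deltaTrunc A l n = ∑ j ∈ Finset.Icc 1 K,
      (∑ k ∈ Finset.Icc 1 K, (k.choose j : R) * A k n) * (delta ^ j : FormalOp R) l n := by
  have hact : (trunc (1 ≤ ·) A).act 1 n = ∑ k ∈ Finset.Icc 1 K, A k n := by
    change (∑ᶠ j : ℤ, (if 1 ≤ j then A j n else 0) * 1) = _
    rw [finsum_eq_sum_of_support_subset (s := (Finset.Icc 1 K).image (Nat.cast : ℕ → ℤ))]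
    · rw [Finset.sum_image (by intro x _ y _ h; exact_mod_cast h)]
      refine Finset.sum_congr rfl fun k hk => ?_
      rw [if_pos (by have := (Finset.mem_Icc.1 hk).1; omega), mul_one]
    · intro j hj
      simp only [Function.mem_support, mul_one, ne_eq, ite_eq_right_iff, Classical.not_imp] at hj
      have : j ≤ K := by
        by_contra hc
        exact hj.2 (hA j (by omega) n)
      simp only [Finset.coe_image, Set.mem_image, Finset.mem_coe, Finset.mem_Icc]
      exact ⟨j.toNat, by omega, by omega⟩
  change (if 1 ≤ l then A l n else 0) - (if l = 0 then (trunc (1 ≤ ·) A).act 1 n else 0) = _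
  rw [hact]
  simp_rw [delta_pow_apply]
  by_cases hl : 0 ≤ l
  · obtain ⟨d, rfl⟩ := Int.eq_ofNat_of_zero_le hl
    simp_rw [if_pos hl, Int.toNat_natCast]
    rw [sum_choose_aux K (fun k => A k n) d, Finset.sum_sub_distrib, Finset.sum_ite_eq]
    congr 1
    · by_cases h1 : 1 ≤ d
      · by_cases h2 : d ≤ K
        · rw [if_pos (by omega), if_pos (by simp [h1, h2])]
        · rw [if_pos (by omega), if_neg (by simp [h2]), hA _ (by omega)]
      · rw [if_neg (by omega), if_neg (by simp [h1])]
    · by_cases h0 : d = 0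
      · simp [h0]
      · simp [h0]
  · rw [if_neg (by omega), if_neg (by omega)]
    simp [hl]

theorem deltaStarTrunc_apply (A : FormalOp R) (K : ℕ) (hA : ∀ j, j < -(K : ℤ) → ∀ n, A j n = 0)
    (l n : ℤ) :
    deltaStarTrunc A l n = ∑ j ∈ Finset.Icc 1 K,
      (∑ k ∈ Finset.Icc 1 K, (k.choose j : R) * A (-k) n) *
        ((delta.adj : FormalOp R) ^ j) l n := by
  have hact : (trunc (· < 0) A).act 1 n = ∑ k ∈ Finset.Icc 1 K, A (-k) n := by
    change (∑ᶠ j : ℤ, (if j < 0 then A j n else 0) * 1) = _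
    rw [finsum_eq_sum_of_support_subset
      (s := (Finset.Icc 1 K).image (fun k : ℕ => -(k : ℤ)))]
    · rw [Finset.sum_image (by intro x _ y _ h; simpa using h)]
      refine Finset.sum_congr rfl fun k hk => ?_
      rw [if_pos (by have := (Finset.mem_Icc.1 hk).1; omega), mul_one]
    · intro j hj
      simp only [Function.mem_support, mul_one, ne_eq, ite_eq_right_iff, Classical.not_imp] at hj
      have : -(K : ℤ) ≤ j := by
        by_contra hc
        exact hj.2 (hA j (by omega) n)
      simp only [Finset.coe_image, Set.mem_image, Finset.mem_coe, Finset.mem_Icc]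
      exact ⟨(-j).toNat, by omega, by omega⟩
  change (if l < 0 then A l n else 0) - (if l = 0 then (trunc (· < 0) A).act 1 n else 0) = _
  rw [hact]
  simp_rw [deltaStar_pow_apply]
  by_cases hl : 0 ≤ -l
  · obtain ⟨d, hd⟩ := Int.eq_ofNat_of_zero_le hl
    obtain rfl : l = -(d : ℤ) := by omega
    simp_rw [if_pos hl, neg_neg, Int.toNat_natCast]
    rw [sum_choose_aux K (fun k => A (-k) n) d, Finset.sum_sub_distrib, Finset.sum_ite_eq]
    congr 1
    · by_cases h1 : 1 ≤ d
      · by_cases h2 : d ≤ K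
        · rw [if_pos (by omega), if_pos (by simp [h1, h2])]
        · rw [if_pos (by omega), if_neg (by simp [h2]), hA _ (by omega)]
      · rw [if_neg (by omega), if_neg (by simp [h1])]
    · by_cases h0 : d = 0
      · simp [h0]
      · simp [h0]
  · rw [if_neg (by omega), if_neg (by omega)]
    simp only [if_neg hl, mul_zero, Finset.sum_const_zero, sub_zero]

end FormalOp

end MiuraToda

namespace MiuraToda
namespace FormalOp

variable {R : Type*} [CommRing R]

/-! If `T` is invertible and `B' T = T B + ∂T`, then `T L T⁻¹` satisfies the Lax equation with `B'`
whenever `L` does with `B`, and `T(q)` is an eigenfunction for `B'` whenever `q` is one for `B`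
(`gauge_lax`, `isGBT_of_gauge`). So the point is to check that the Toda operator of the conjugated
pair is this `B'`.

Let `B` be the modified Toda operator and `g` the function by which the Toda truncation of the same
power exceeds it (`todaDefect`). Degree zero of the wave equations gives `∂c₀ = -g c₀`. Conjugation
by a function commutes with truncation, so for `T₁` the Toda operator is `c₀⁻¹ (B + g) c₀`. For
`T₂`, since `B(1) = 0`, the quotient `B Δ⁻¹` is a Laurent polynomial independent of the expansion,
and the truncation of the `Δ`-conjugated power is `Δ B Δ⁻¹ + g(n+1)` (`trunc_nonneg_delta_conj`,
`trunc_neg_delta_conj`). In both cases `∂(c₀⁻¹) = c₀⁻¹ g` gives the gauge relation.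

The constraint transforms by `A · qΛ^l r = A(q)Λ^l r` and its adjoint, summed over `l`. The adjoint
eigenfunctions are controlled by `∂r(n+1) = (B Δ⁻¹)^*(Δr)(n)`.

Two-sided operators do not form a ring. Associativity is used only among operators bounded on the
same side or with two Laurent factors, which suffices because the two expansions meet only in the
constraint. -/

@[simp] theorem add_apply (A B : FormalOp R) (j n : ℤ) : (A + B) j n = A j n + B j n := rfl

@[simp] theorem sub_apply (A B : FormalOp R) (j n : ℤ) : (A - B) j n = A j n - B j n := rfl

@[simp] theorem neg_apply (A : FormalOp R) (j n : ℤ) : (-A) j n = -A j n := rfl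

@[simp] theorem zero_apply (j n : ℤ) : (0 : FormalOp R) j n = 0 := rfl

theorem mulOp_apply (f : ℤ → R) (j n : ℤ) : mulOp f j n = if j = 0 then f n else 0 := rfl

theorem pow_succ_eq (A : FormalOp R) (k : ℕ) : A ^ (k + 1) = A ^ k * A := rfl

/-! ### Convolution products: finiteness, Leibniz rule, associativity. -/

/-- The convolution defining `A * B` is finite in every degree. -/
def Compat (A B : FormalOp R) : Prop :=
  ∀ j : ℤ, ∃ I : Finset ℤ, ∀ i, i ∉ I → (∀ n, A i n = 0) ∨ ∀ n, B (j - i) n = 0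

/-- `A * B` as a finite sum. -/
theorem mul_apply_eq_sum {A B : FormalOp R} {j n : ℤ} (I : Finset ℤ)
    (h : ∀ i, i ∉ I → A i n * B (j - i) (n + i) = 0) :
    (A * B) j n = ∑ i ∈ I, A i n * B (j - i) (n + i) := by
  rw [mul_apply]
  refine finsum_eq_sum_of_support_subset _ fun i hi => ?_
  by_contra hc
  exact hi (h i (by simpa using hc))

theorem mul_eq_zero_of_or {A B : FormalOp R} {i j : ℤ}
    (h : (∀ n, A i n = 0) ∨ ∀ n, B (j - i) n = 0) (n : ℤ) : A i n * B (j - i) (n + i) = 0 := by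
  rcases h with h | h <;> simp [h]

theorem Compat.add_mul {A A' B : FormalOp R} (h : Compat A B) (h' : Compat A' B) :
    (A + A') * B = A * B + A' * B := by
  ext j n
  obtain ⟨I, hI⟩ := h j
  obtain ⟨I', hI'⟩ := h' j
  have e : ∀ i, i ∉ I ∪ I' → A i n * B (j - i) (n + i) = 0 := fun i hi =>
    mul_eq_zero_of_or (hI i fun h => hi (Finset.mem_union_left _ h)) n
  have e' : ∀ i, i ∉ I ∪ I' → A' i n * B (j - i) (n + i) = 0 := fun i hi =>
    mul_eq_zero_of_or (hI' i fun h => hi (Finset.mem_union_right _ h)) n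
  rw [add_apply, mul_apply_eq_sum (I ∪ I') e, mul_apply_eq_sum (I ∪ I') e',
    mul_apply_eq_sum (I ∪ I') fun i hi => by
      rw [add_apply, _root_.add_mul, e i hi, e' i hi, add_zero], ← Finset.sum_add_distrib]
  exact Finset.sum_congr rfl fun i _ => by rw [add_apply, _root_.add_mul]

theorem Compat.mul_add {A B B' : FormalOp R} (h : Compat A B) (h' : Compat A B') :
    A * (B + B') = A * B + A * B' := by
  ext j n
  obtain ⟨I, hI⟩ := h j
  obtain ⟨I', hI'⟩ := h' j
  have e : ∀ i, i ∉ I ∪ I' → A i n * B (j - i) (n + i) = 0 := fun i hi =>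
    mul_eq_zero_of_or (hI i fun h => hi (Finset.mem_union_left _ h)) n
  have e' : ∀ i, i ∉ I ∪ I' → A i n * B' (j - i) (n + i) = 0 := fun i hi =>
    mul_eq_zero_of_or (hI' i fun h => hi (Finset.mem_union_right _ h)) n
  rw [add_apply, mul_apply_eq_sum (I ∪ I') e, mul_apply_eq_sum (I ∪ I') e',
    mul_apply_eq_sum (I ∪ I') fun i hi => by
      rw [add_apply, _root_.mul_add, e i hi, e' i hi, add_zero], ← Finset.sum_add_distrib]
  exact Finset.sum_congr rfl fun i _ => by rw [add_apply, _root_.mul_add]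

/-- The Leibniz rule is applied term by term to a finite sum. `Compat` makes a whole coefficient of
one factor vanish, not merely a product of values; this is what survives differentiation of either
factor. -/
theorem Compat.derivOp_mul {K : Type*} [CommRing K] [Algebra K R] (D : Derivation K R R)
    {A B : FormalOp R} (h : Compat A B) :
    derivOp D (A * B) = derivOp D A * B + A * derivOp D B := by
  ext j n
  obtain ⟨I, hI⟩ := h j
  have e : ∀ i, i ∉ I → derivOp D A i n * B (j - i) (n + i) = 0 := fun i hi => by
    rcases hI i hi with h | h <;> simp [derivOp, h]
  have e' : ∀ i, i ∉ I → A i n * derivOp D B (j - i) (n + i) = 0 := fun i hi => by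
    rcases hI i hi with h | h <;> simp [derivOp, h]
  change D ((A * B) j n) = (derivOp D A * B) j n + (A * derivOp D B) j n
  rw [mul_apply_eq_sum I e, mul_apply_eq_sum I e',
    mul_apply_eq_sum I fun i hi => mul_eq_zero_of_or (hI i hi) n, map_sum,
    ← Finset.sum_add_distrib]
  refine Finset.sum_congr rfl fun i _ => ?_
  rw [Derivation.leibniz, smul_eq_mul, smul_eq_mul, add_comm, mul_comm (B _ _)]
  rfl

/-- Both sides are one double sum over the degree `i` of `A` and the total degree `k` of `A * B`,
taken in two orders. The finite windows `I` and `K` must be common to both orders for the exchange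
to be legitimate. -/
theorem mul_assoc_apply {A B C : FormalOp R} {j n : ℤ} (I K : Finset ℤ)
    (h₁ : ∀ k ∈ K, ∀ i, i ∉ I → A i n * B (k - i) (n + i) = 0)
    (h₂ : ∀ k, k ∉ K → (A * B) k n * C (j - k) (n + k) = 0)
    (h₃ : ∀ i ∈ I, ∀ k, k ∉ K → B (k - i) (n + i) * C (j - k) (n + k) = 0)
    (h₄ : ∀ i, i ∉ I → A i n * (B * C) (j - i) (n + i) = 0) :
    (A * B * C) j n = (A * (B * C)) j n := by
  rw [mul_apply_eq_sum K h₂, mul_apply_eq_sum I h₄]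
  calc _ = ∑ k ∈ K, ∑ i ∈ I, A i n * B (k - i) (n + i) * C (j - k) (n + k) :=
        Finset.sum_congr rfl fun k hk => by
          rw [mul_apply_eq_sum I (h₁ k hk), Finset.sum_mul]
    _ = ∑ i ∈ I, ∑ k ∈ K, A i n * B (k - i) (n + i) * C (j - k) (n + k) := Finset.sum_comm
    _ = _ := Finset.sum_congr rfl fun i hi => by
        have e : (B * C) (j - i) (n + i) =
            ∑ k ∈ K, B (k - i) (n + i) * C (j - k) (n + k) := by
          rw [mul_apply_eq_sum (K.map (Equiv.subRight i).toEmbedding)]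
          · rw [Finset.sum_map]
            refine Finset.sum_congr rfl fun k _ => ?_
            simp only [Equiv.toEmbedding_apply, Equiv.subRight_apply]
            rw [show j - i - (k - i) = j - k by ring, show n + i + (k - i) = n + k by ring]
          · intro k hk
            have := h₃ i hi (k + i) fun h => hk
              (Finset.mem_map.2 ⟨k + i, h, by simp⟩)
            rw [show k + i - i = k by ring] at this
            rw [show j - i - k = j - (k + i) by ring, show n + i + k = n + (k + i) by ring]
            exact this
        rw [e, Finset.mul_sum]
        exact Finset.sum_congr rfl fun k _ => mul_assoc _ _ _

theorem mulOp_mul_apply (f : ℤ → R) (A : FormalOp R) (j n : ℤ) :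
    (mulOp f * A) j n = f n * A j n := by
  rw [mul_apply_eq_sum {0} fun i hi => by
    rw [mulOp_apply, if_neg (by simpa using hi), zero_mul]]
  simp [mulOp_apply]

theorem mul_mulOp_apply (f : ℤ → R) (A : FormalOp R) (j n : ℤ) :
    (A * mulOp f) j n = A j n * f (n + j) := by
  rw [mul_apply_eq_sum {j} fun i hi => by
    rw [mulOp_apply, if_neg (by simp at hi; omega), mul_zero]]
  simp [mulOp_apply]

theorem shift_mul_apply (A : FormalOp R) (j n : ℤ) : (shift * A : FormalOp R) j n = A (j - 1) (n + 1) := by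
  rw [mul_apply_eq_sum {1} fun i hi => by
    rw [shift, if_neg (by simpa using hi), zero_mul]]
  simp [shift]

theorem one_mul_eq (A : FormalOp R) : 1 * A = A := by
  ext j n
  exact (mulOp_mul_apply 1 A j n).trans (one_mul _)

theorem mul_one_eq (A : FormalOp R) : A * 1 = A := by
  ext j n
  exact (mul_mulOp_apply 1 A j n).trans (mul_one _)

/-! ### Operators bounded in degree on one side, and the rings they form. -/

/-- The degrees `j` of the nonzero coefficients of `A` satisfy `s j ≤ d`. -/
def SuppLE (s : ℤˣ) (d : ℤ) (A : FormalOp R) : Prop := ∀ j, d < s * j → ∀ n, A j n = 0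

section SuppLE

variable {s : ℤˣ} {a b : ℤ} {A B : FormalOp R}

theorem SuppLE.mul (hA : SuppLE s a A) (hB : SuppLE s b B) : SuppLE s (a + b) (A * B) := by
  intro j hj n
  rw [mul_apply_eq_sum ∅, Finset.sum_empty]
  intro i _
  refine mul_eq_zero_of_or ?_ n
  by_cases h : a < s * i
  · exact .inl (hA i h)
  · refine .inr (hB _ ?_)
    rw [_root_.mul_sub]
    omega

/-- The extremal coefficient of a product. -/
theorem SuppLE.mul_apply_extremal (hA : SuppLE s a A) (hB : SuppLE s b B) (n : ℤ) :
    (A * B) (s * (a + b)) n = A (s * a) n * B (s * b) (n + s * a) := by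
  rw [mul_apply_eq_sum {↑s * a}]
  · rw [Finset.sum_singleton, _root_.mul_add, add_sub_cancel_left]
  · intro i hi
    refine mul_eq_zero_of_or ?_ n
    rcases lt_trichotomy (s * i) a with h | h | h
    · refine .inr (hB _ ?_)
      rw [_root_.mul_sub, ← mul_assoc, Int.units_coe_mul_self, one_mul]
      omega
    · exact (hi (by rw [← h, ← mul_assoc, Int.units_coe_mul_self, one_mul]; simp)).elim
    · exact .inl (hA i h)

theorem SuppLE.compat (hA : SuppLE s a A) (hB : SuppLE s b B) : Compat A B := by
  intro j
  refine ⟨Finset.Icc (-(a.natAbs + b.natAbs + j.natAbs)) (a.natAbs + b.natAbs + j.natAbs),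
    fun i hi => ?_⟩
  rw [Finset.mem_Icc] at hi
  by_cases h : a < s * i
  · exact .inl (hA i h)
  · refine .inr (hB _ ?_)
    rcases Int.units_eq_one_or s with rfl | rfl <;>
      simp only [Units.val_one, Units.val_neg] at h ⊢ <;> omega

theorem SuppLE.mul_eq_zero (hA : SuppLE s a A) (hB : SuppLE s b B) {i j n n' : ℤ}
    (h : a < s * i ∨ b < s * j) : A i n * B j n' = 0 := by
  rcases h with h | h
  · rw [hA i h, zero_mul]
  · rw [hB j h, mul_zero]

theorem SuppLE.mul_assoc {c : ℤ} {C : FormalOp R} (hA : SuppLE s a A) (hB : SuppLE s b B)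
    (hC : SuppLE s c C) : A * B * C = A * (B * C) := by
  ext j n
  -- A contributing pair has `s i ≤ a`, `s (k - i) ≤ b` and `s (j - k) ≤ c`, which confines `i` and
  -- `k` to a box of size `Z`; the filters impose the first and third conditions.
  set Z : ℤ := a.natAbs + b.natAbs + c.natAbs + j.natAbs with hZ
  refine mul_assoc_apply ((Finset.Icc (-Z) Z).filter fun i => s * i ≤ a)
    ((Finset.Icc (-Z) Z).filter fun k => s * j - c ≤ s * k) ?_ ?_ ?_ ?_
  · intro k hk i hi
    refine hA.mul_eq_zero hB ?_
    rw [Finset.mem_filter, Finset.mem_Icc] at hk hi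
    rcases Int.units_eq_one_or s with rfl | rfl <;>
      simp only [Units.val_one, Units.val_neg] at hk hi ⊢ <;> omega
  · intro k hk
    refine (hA.mul hB).mul_eq_zero hC ?_
    rw [Finset.mem_filter, Finset.mem_Icc] at hk
    rcases Int.units_eq_one_or s with rfl | rfl <;>
      simp only [Units.val_one, Units.val_neg] at hk ⊢ <;> omega
  · intro i hi k hk
    refine hB.mul_eq_zero hC ?_
    rw [Finset.mem_filter, Finset.mem_Icc] at hk hi
    rcases Int.units_eq_one_or s with rfl | rfl <;>
      simp only [Units.val_one, Units.val_neg] at hk hi ⊢ <;> omega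
  · intro i hi
    refine hA.mul_eq_zero (hB.mul hC) ?_
    rw [Finset.mem_filter, Finset.mem_Icc] at hi
    rcases Int.units_eq_one_or s with rfl | rfl <;>
      simp only [Units.val_one, Units.val_neg] at hi ⊢ <;> omega

end SuppLE

variable (R) in
/-- The operators with coefficients bounded in degree on one side: `𝒜[[Λ⁻¹]][Λ]` for `s = 1` and
`𝒜[[Λ]][Λ⁻¹]` for `s = -1`. -/
def oneSided (s : ℤˣ) : AddSubgroup (FormalOp R) where
  carrier := {A | ∃ d, SuppLE s d A}
  zero_mem' := ⟨0, fun _ _ _ => rfl⟩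
  add_mem' := by
    rintro A B ⟨a, hA⟩ ⟨b, hB⟩
    refine ⟨max a b, fun j hj n => ?_⟩
    rw [add_apply, hA j ((le_max_left _ _).trans_lt hj), hB j ((le_max_right _ _).trans_lt hj),
      add_zero]
  neg_mem' := by
    rintro A ⟨a, hA⟩
    exact ⟨a, fun j hj n => by rw [neg_apply, hA j hj, neg_zero]⟩

section oneSided

variable {s : ℤˣ} {A B : FormalOp R}

theorem SuppLE.mem {a : ℤ} (h : SuppLE s a A) : A ∈ oneSided R s := ⟨a, h⟩

theorem mul_mem_oneSided (hA : A ∈ oneSided R s) (hB : B ∈ oneSided R s) :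
    A * B ∈ oneSided R s := by
  obtain ⟨a, hA⟩ := hA
  obtain ⟨b, hB⟩ := hB
  exact (hA.mul hB).mem

theorem suppLE_mulOp (f : ℤ → R) : SuppLE s 0 (mulOp f) := by
  intro j hj n
  rw [mulOp_apply, if_neg]
  rintro rfl
  simp at hj

theorem mulOp_mem_oneSided (f : ℤ → R) : mulOp f ∈ oneSided R s := (suppLE_mulOp f).mem

theorem compat_of_mem_oneSided (hA : A ∈ oneSided R s) (hB : B ∈ oneSided R s) :
    Compat A B := by
  obtain ⟨a, hA⟩ := hA
  obtain ⟨b, hB⟩ := hB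
  exact hA.compat hB

/-- Packaging each side as a genuine ring makes units, conjugation of powers and noncommutative
algebra available for operators whose ambient type is not a ring. -/
noncomputable instance (s : ℤˣ) : Ring (oneSided R s) :=
  { (inferInstance : AddCommGroup (oneSided R s)) with
    mul := fun A B => ⟨A.1 * B.1, mul_mem_oneSided A.2 B.2⟩
    one := ⟨1, mulOp_mem_oneSided 1⟩
    mul_assoc := fun A B C => by
      obtain ⟨A, a, hA⟩ := A
      obtain ⟨B, b, hB⟩ := B
      obtain ⟨C, c, hC⟩ := C
      exact Subtype.ext (hA.mul_assoc hB hC)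
    one_mul := fun A => Subtype.ext (one_mul_eq A.1)
    mul_one := fun A => Subtype.ext (mul_one_eq A.1)
    left_distrib := fun A B C => Subtype.ext
      ((compat_of_mem_oneSided A.2 B.2).mul_add (compat_of_mem_oneSided A.2 C.2))
    right_distrib := fun A B C => Subtype.ext
      ((compat_of_mem_oneSided A.2 C.2).add_mul (compat_of_mem_oneSided B.2 C.2))
    zero_mul := fun A => Subtype.ext <| by
      have h := (compat_of_mem_oneSided (0 : oneSided R s).2 A.2).add_mul
        (compat_of_mem_oneSided (0 : oneSided R s).2 A.2)
      have e : ((0 : oneSided R s) : FormalOp R) = 0 := rfl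
      rw [e, add_zero] at h
      exact left_eq_add.1 h
    mul_zero := fun A => Subtype.ext <| by
      have h := (compat_of_mem_oneSided A.2 (0 : oneSided R s).2).mul_add
        (compat_of_mem_oneSided A.2 (0 : oneSided R s).2)
      have e : ((0 : oneSided R s) : FormalOp R) = 0 := rfl
      rw [e, add_zero] at h
      exact left_eq_add.1 h }

theorem coe_mul_oneSided (A B : oneSided R s) :
    ((A * B : oneSided R s) : FormalOp R) = (A : FormalOp R) * B := rfl

theorem coe_pow_oneSided (A : oneSided R s) (k : ℕ) :
    ((A ^ k : oneSided R s) : FormalOp R) = (A : FormalOp R) ^ k := by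
  induction k with
  | zero => rfl
  | succ k ih => rw [pow_succ, coe_mul_oneSided, ih, pow_succ_eq]

theorem pow_mem_oneSided (hA : A ∈ oneSided R s) (k : ℕ) : A ^ k ∈ oneSided R s :=
  coe_pow_oneSided ⟨A, hA⟩ k ▸ ((⟨A, hA⟩ : oneSided R s) ^ k).2

theorem mul_assoc_of_mem {C : FormalOp R} (hA : A ∈ oneSided R s) (hB : B ∈ oneSided R s)
    (hC : C ∈ oneSided R s) : A * B * C = A * (B * C) :=
  congrArg Subtype.val
    (mul_assoc (⟨A, hA⟩ : oneSided R s) (⟨B, hB⟩ : oneSided R s) (⟨C, hC⟩ : oneSided R s))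

/-- A derivation of the coefficients as a map of one-sided operators. -/
def derivOneSided {K : Type*} [CommRing K] [Algebra K R] (D : Derivation K R R) (s : ℤˣ) :
    oneSided R s →+ oneSided R s where
  toFun A := ⟨derivOp D A, by
    obtain ⟨A, a, hA⟩ := A
    exact ⟨a, fun j hj n => by change D (A j n) = 0; rw [hA j hj, map_zero]⟩⟩
  map_zero' := Subtype.ext <| by
    ext j n
    exact map_zero D
  map_add' A B := Subtype.ext <| by
    ext j n
    exact map_add D _ _

theorem derivOneSided_mul {K : Type*} [CommRing K] [Algebra K R] (D : Derivation K R R)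
    (A B : oneSided R s) : derivOneSided D s (A * B) =
      derivOneSided D s A * B + A * derivOneSided D s B :=
  Subtype.ext ((compat_of_mem_oneSided A.2 B.2).derivOp_mul D)

end oneSided

/-! ### Laurent polynomials as multipliers of arbitrary two-sided operators. -/

/-- Laurent polynomials in `Λ`. -/
def IsLaurent (A : FormalOp R) : Prop := ∀ s, A ∈ oneSided R s

section IsLaurent

variable {A B : FormalOp R}

theorem IsLaurent.mul (hA : IsLaurent A) (hB : IsLaurent B) : IsLaurent (A * B) :=
  fun s => mul_mem_oneSided (hA s) (hB s)

theorem IsLaurent.add (hA : IsLaurent A) (hB : IsLaurent B) : IsLaurent (A + B) :=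
  fun s => add_mem (hA s) (hB s)

theorem IsLaurent.sub (hA : IsLaurent A) (hB : IsLaurent B) : IsLaurent (A - B) :=
  fun s => sub_mem (hA s) (hB s)

theorem IsLaurent.neg (hA : IsLaurent A) : IsLaurent (-A) := fun s => neg_mem (hA s)

theorem isLaurent_mulOp (f : ℤ → R) : IsLaurent (mulOp f) := fun _ => mulOp_mem_oneSided f

theorem IsLaurent.exists_support (hA : IsLaurent A) :
    ∃ K : ℤ, ∀ j, j ∉ Finset.Icc (-K) K → ∀ n, A j n = 0 := by
  obtain ⟨a, ha⟩ := hA 1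
  obtain ⟨b, hb⟩ := hA (-1)
  refine ⟨max a b, fun j hj => ?_⟩
  rw [Finset.mem_Icc] at hj
  by_cases h : a < j
  · exact ha j (by simpa using h)
  · refine hb j ?_
    simp only [Units.val_one, Units.val_neg]
    omega

/-- Finite support of `A` and `B` alone bounds both summation windows, so `C` may be infinite in
both directions; this covers `constCoeff f`, on which the rules for `act` rest. -/
theorem IsLaurent.mul_assoc {C : FormalOp R} (hA : IsLaurent A) (hB : IsLaurent B) :
    A * B * C = A * (B * C) := by
  ext j n
  obtain ⟨a, ha⟩ := hA.exists_support
  obtain ⟨b, hb⟩ := hB.exists_support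
  have hAB : ∀ k, k ∉ Finset.Icc (-(|a| + |b|)) (|a| + |b|) → (A * B) k n = 0 := by
    intro k hk
    rw [mul_apply_eq_sum ∅, Finset.sum_empty]
    intro i _
    refine mul_eq_zero_of_or ?_ n
    by_cases h : i ∈ Finset.Icc (-a) a
    · refine .inr (hb _ ?_)
      simp only [Finset.mem_Icc] at h hk ⊢
      rw [abs_of_nonneg (show 0 ≤ a by omega)] at hk
      have := le_abs_self b
      omega
    · exact .inl (ha i h)
  refine mul_assoc_apply (Finset.Icc (-a) a) (Finset.Icc (-(|a| + |b|)) (|a| + |b|))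
    (fun k _ i hi => by rw [ha i hi, zero_mul]) (fun k hk => by rw [hAB k hk, zero_mul])
    (fun i h k hk => ?_) fun i hi => by rw [ha i hi, zero_mul]
  rw [hb, zero_mul]
  simp only [Finset.mem_Icc] at h hk ⊢
  rw [abs_of_nonneg (show 0 ≤ a by omega)] at hk
  have := le_abs_self b
  omega

theorem IsLaurent.compat_left (hA : IsLaurent A) : Compat A B := by
  obtain ⟨a, ha⟩ := hA.exists_support
  exact fun j => ⟨Finset.Icc (-a) a, fun i hi => .inl (ha i hi)⟩

theorem IsLaurent.compat_right (hB : IsLaurent B) : Compat A B := by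
  obtain ⟨b, hb⟩ := hB.exists_support
  refine fun j => ⟨Finset.Icc (j - b) (j + b), fun i hi => .inr (hb _ ?_)⟩
  rw [Finset.mem_Icc] at hi ⊢
  omega

theorem isLaurent_shift : IsLaurent (shift : FormalOp R) := by
  intro s
  refine ⟨1, fun j hj n => ?_⟩
  rw [shift, if_neg]
  rintro rfl
  rcases Int.units_eq_one_or s with rfl | rfl <;> simp at hj

theorem isLaurent_one : IsLaurent (1 : FormalOp R) := isLaurent_mulOp 1

theorem isLaurent_delta : IsLaurent (delta : FormalOp R) := isLaurent_shift.sub isLaurent_one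

theorem IsLaurent.adj (hA : IsLaurent A) : IsLaurent A.adj := by
  intro s
  obtain ⟨a, ha⟩ := hA (-s)
  refine ⟨a, fun j hj n => ha (-j) ?_ _⟩
  simpa using hj

end IsLaurent

/-! ### Action on functions, and adjoints. -/

/-- The operator `∑_l f Λ^l`, all of whose coefficients are `f`. -/
def constCoeff (f : ℤ → R) : FormalOp R := fun _ n => f n

/-- This turns the action on functions into a product, so that composition, additivity and the
Leibniz rule for `act` are read off from those of operators. -/
theorem mul_constCoeff (A : FormalOp R) (f : ℤ → R) :
    A * constCoeff f = constCoeff (A.act f) := rfl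

theorem act_eq_mul_apply (A : FormalOp R) (f : ℤ → R) (n : ℤ) :
    A.act f n = (A * constCoeff f) 0 n := rfl

theorem IsLaurent.act_mul {A B : FormalOp R} (hA : IsLaurent A) (hB : IsLaurent B)
    (f : ℤ → R) : (A * B).act f = A.act (B.act f) := by
  funext n
  rw [act_eq_mul_apply, hA.mul_assoc hB]
  rfl

theorem IsLaurent.add_act {A B : FormalOp R} (hA : IsLaurent A) (hB : IsLaurent B)
    (f : ℤ → R) : (A + B).act f = A.act f + B.act f := by
  funext n
  rw [act_eq_mul_apply, hA.compat_left.add_mul hB.compat_left]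
  rfl

theorem act_neg (A : FormalOp R) (f : ℤ → R) : A.act (-f) = -A.act f := by
  funext n
  change ∑ᶠ j, A j n * -f (n + j) = -∑ᶠ j, A j n * f (n + j)
  rw [← finsum_neg_distrib]
  exact finsum_congr fun j => mul_neg _ _

theorem neg_act (A : FormalOp R) (f : ℤ → R) : (-A).act f = -A.act f := by
  funext n
  change ∑ᶠ j, -A j n * f (n + j) = -∑ᶠ j, A j n * f (n + j)
  rw [← finsum_neg_distrib]
  exact finsum_congr fun j => neg_mul _ _

theorem IsLaurent.sub_act {A B : FormalOp R} (hA : IsLaurent A) (hB : IsLaurent B)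
    (f : ℤ → R) : (A - B).act f = A.act f - B.act f := by
  rw [sub_eq_add_neg, hA.add_act hB.neg, neg_act, sub_eq_add_neg]

theorem IsLaurent.deriv_act {K : Type*} [CommRing K] [Algebra K R] (D : Derivation K R R)
    {A : FormalOp R} (hA : IsLaurent A) (f : ℤ → R) (n : ℤ) :
    D (A.act f n) = (derivOp D A).act f n + A.act (fun k => D (f k)) n :=
  congrFun (congrFun ((hA.compat_left (B := constCoeff f)).derivOp_mul D) 0) n

theorem mulOp_act (f w : ℤ → R) (n : ℤ) : (mulOp f).act w n = f n * w n :=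
  mulOp_mul_apply f (constCoeff w) 0 n

theorem delta_mul_apply (A : FormalOp R) (j n : ℤ) :
    (delta * A : FormalOp R) j n = A (j - 1) (n + 1) - A j n := by
  rw [delta, sub_eq_add_neg shift, isLaurent_shift.compat_left.add_mul isLaurent_one.neg.compat_left,
    add_apply, shift_mul_apply, sub_eq_add_neg (A _ _)]
  refine congrArg (A (j - 1) (n + 1) + ·) ?_
  -- Without a ring structure, `(-1) * A = -A` is extracted from `(1 + (-1)) * A = 0`.
  have h := congrFun (congrFun (isLaurent_one.compat_left.add_mul
    (B := A) (isLaurent_one.neg.compat_left)) j) n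
  rw [add_neg_cancel, add_apply, one_mul_eq] at h
  refine eq_neg_of_add_eq_zero_right (h.symm.trans ?_)
  rw [mul_apply_eq_sum ∅ fun i _ => by rw [zero_apply, zero_mul], Finset.sum_empty]

theorem delta_act (f : ℤ → R) : (delta : FormalOp R).act f = deltaFun f :=
  funext fun n => delta_mul_apply (constCoeff f) 0 n

theorem adj_adj {R : Type*} (A : FormalOp R) : A.adj.adj = A := by
  ext j n
  change A (- -j) (n + j + -j) = A j n
  rw [neg_neg, add_neg_cancel_right]

/-- The substitution `i = k - j` is a bijection between the summands of the two convolutions, so no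
finiteness assumption is needed. -/
theorem adj_mul (A B : FormalOp R) : (A * B).adj = B.adj * A.adj := by
  ext j n
  change ∑ᶠ i, A i (n + j) * B (-j - i) (n + j + i) =
    ∑ᶠ k, B (-k) (n + k) * A (-(j - k)) (n + k + (j - k))
  refine (finsum_comp_equiv (Equiv.subRight j)).symm.trans (finsum_congr fun k => ?_)
  simp only [Equiv.subRight_apply]
  rw [mul_comm, show -j - (k - j) = -k by ring, show n + j + (k - j) = n + k by ring,
    show -(j - k) = k - j by ring, show n + k + (j - k) = n + j by ring]

theorem adj_add (A B : FormalOp R) : (A + B).adj = A.adj + B.adj := rfl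

theorem adj_mulOp (f : ℤ → R) : (mulOp f).adj = mulOp f := by
  ext j n
  change (if -j = 0 then f (n + j) else 0) = if j = 0 then f n else 0
  by_cases h : j = 0
  · simp [h]
  · simp [h]

theorem adj_delta_mul_apply (A : FormalOp R) (j n : ℤ) :
    (delta.adj * A : FormalOp R) j n = A (j + 1) (n - 1) - A j n := by
  rw [← adj_adj (delta.adj * A), adj_mul, adj_adj]
  change (A.adj * delta : FormalOp R) (-j) (n + j) = _
  rw [mul_delta_apply]
  change A (-(-j - 1)) (n + j + (-j - 1)) - A (- -j) (n + j + -j) = _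
  rw [show -(-j - 1) = j + 1 by ring, show n + j + (-j - 1) = n - 1 by ring, neg_neg,
    add_neg_cancel_right]

theorem adj_delta_act (f : ℤ → R) (n : ℤ) :
    (delta.adj : FormalOp R).act f n = f (n - 1) - f n :=
  adj_delta_mul_apply (constCoeff f) 0 n

/-! ### Products with `q Λ^l r` -/

/-- In the convolution, `r` is always evaluated at `n + i + (l - i) = n + l`, so it factors out of
the sum over `i`. -/
theorem IsLaurent.mul_bilateral {A : FormalOp R} (hA : IsLaurent A) (q r : ℤ → R) :
    A * bilateral q r = bilateral (A.act q) r := by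
  obtain ⟨K, hK⟩ := hA.exists_support
  ext l n
  change _ = A.act q n * r (n + l)
  rw [act_eq_mul_apply, mul_apply_eq_sum (Finset.Icc (-K) K) fun i hi => by rw [hK i hi, zero_mul],
    mul_apply_eq_sum (Finset.Icc (-K) K) fun i hi => by rw [hK i hi, zero_mul], Finset.sum_mul]
  refine Finset.sum_congr rfl fun i _ => ?_
  change A i n * (q (n + i) * r (n + i + (l - i))) = A i n * q (n + i) * r (n + l)
  rw [show n + i + (l - i) = n + l by ring]
  exact (_root_.mul_assoc _ _ _).symm

theorem adj_bilateral (q r : ℤ → R) : (bilateral q r).adj = bilateral r q := by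
  ext l n
  change q (n + l) * r (n + l + -l) = r n * q (n + l)
  rw [add_neg_cancel_right, mul_comm]

theorem IsLaurent.bilateral_mul {A : FormalOp R} (hA : IsLaurent A) (q r : ℤ → R) :
    bilateral q r * A = bilateral q (A.adj.act r) := by
  rw [← adj_adj (bilateral q r * A), adj_mul, adj_bilateral, hA.adj.mul_bilateral, adj_bilateral]

theorem IsLaurent.mul_sum {ι : Type*} {A : FormalOp R} (hA : IsLaurent A) (t : Finset ι)
    (F : ι → FormalOp R) : A * ∑ i ∈ t, F i = ∑ i ∈ t, A * F i := by
  let φ : FormalOp R →+ FormalOp R :=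
    AddMonoidHom.mk' (A * ·) fun _ _ => hA.compat_left.mul_add hA.compat_left
  exact map_sum φ F t

theorem IsLaurent.sum_mul {ι : Type*} {A : FormalOp R} (hA : IsLaurent A) (t : Finset ι)
    (F : ι → FormalOp R) : (∑ i ∈ t, F i) * A = ∑ i ∈ t, F i * A := by
  let φ : FormalOp R →+ FormalOp R :=
    AddMonoidHom.mk' (· * A) fun _ _ => hA.compat_right.add_mul hA.compat_right
  exact map_sum φ F t

/-! ### The two expansions of `Δ⁻¹` -/

theorem suppLE_deltaInvMinus : SuppLE 1 (-1) (deltaInvMinus : FormalOp R) := by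
  intro j hj n
  rw [deltaInvMinus, if_neg]
  simpa using hj

theorem suppLE_deltaInvPlus : SuppLE (-1) 0 (deltaInvPlus : FormalOp R) := by
  intro j hj n
  rw [deltaInvPlus, if_neg]
  simpa using hj

theorem delta_mul_deltaInvMinus : (delta * deltaInvMinus : FormalOp R) = 1 := by
  ext j n
  rw [delta_mul_apply]
  change (if j - 1 ≤ -1 then (1 : R) else 0) - (if j ≤ -1 then 1 else 0) = if j = 0 then 1 else 0
  split_ifs <;> first | omega | simp

theorem deltaInvMinus_mul_delta : (deltaInvMinus * delta : FormalOp R) = 1 := by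
  ext j n
  rw [mul_delta_apply]
  change (if j - 1 ≤ -1 then (1 : R) else 0) - (if j ≤ -1 then 1 else 0) = if j = 0 then 1 else 0
  split_ifs <;> first | omega | simp

theorem delta_mul_deltaInvPlus : (delta * deltaInvPlus : FormalOp R) = 1 := by
  ext j n
  rw [delta_mul_apply]
  change (if 0 ≤ j - 1 then (-1 : R) else 0) - (if 0 ≤ j then -1 else 0) = if j = 0 then 1 else 0
  split_ifs <;> first | omega | simp

theorem deltaInvPlus_mul_delta : (deltaInvPlus * delta : FormalOp R) = 1 := by
  ext j n
  rw [mul_delta_apply]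
  change (if 0 ≤ j - 1 then (-1 : R) else 0) - (if 0 ≤ j then -1 else 0) = if j = 0 then 1 else 0
  split_ifs <;> first | omega | simp

/-- If `B(1) = 0`, then `B Δ⁻¹` does not depend on the expansion of `Δ⁻¹`. -/
theorem IsLaurent.mul_deltaInv {B : FormalOp R} (hB : IsLaurent B) (h1 : B.act 1 = 0) :
    B * deltaInvMinus = B * deltaInvPlus := by
  -- The two expansions of `Δ⁻¹` differ by `∑_l Λ^l`, and left multiplication of this series by `B`
  -- produces `B(1)`.
  have e : (deltaInvMinus : FormalOp R) = deltaInvPlus + constCoeff 1 := by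
    ext j n
    change (if j ≤ -1 then (1 : R) else 0) = (if 0 ≤ j then -1 else 0) + 1
    split_ifs <;> first | omega | simp
  rw [e, hB.compat_left.mul_add hB.compat_left, mul_constCoeff, h1]
  exact add_zero _

/-- One expansion bounds the degrees above, the other below, and they give the same product. -/
theorem IsLaurent.isLaurent_mul_deltaInv {B : FormalOp R} (hB : IsLaurent B)
    (h1 : B.act 1 = 0) : IsLaurent (B * deltaInvMinus) := by
  intro s
  rcases Int.units_eq_one_or s with rfl | rfl
  · exact mul_mem_oneSided (hB 1) suppLE_deltaInvMinus.mem
  · rw [hB.mul_deltaInv h1]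
    exact mul_mem_oneSided (hB (-1)) suppLE_deltaInvPlus.mem

theorem IsLaurent.mul_deltaInv_mul_delta {B : FormalOp R} (hB : IsLaurent B) :
    B * deltaInvMinus * delta = B := by
  rw [mul_assoc_of_mem (hB 1) suppLE_deltaInvMinus.mem (isLaurent_delta 1),
    deltaInvMinus_mul_delta, mul_one_eq]

/-- The evolution operator of `r`: `Λ Δ⁻¹ (C Δ)^* Δ = - C^* Δ`. -/
theorem IsLaurent.deltaInv_adj_delta_act {C : FormalOp R} (hC : IsLaurent C) (r : ℤ → R) (n : ℤ) :
    (deltaInvMinus * (C * delta).adj * delta).act r (n + 1) = -C.adj.act (deltaFun r) n := by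
  -- `Δ^* = Λ⁻¹ - 1 = -Δ Λ⁻¹`, so `Δ⁻¹ Δ^*` reduces to `-Λ⁻¹`; this is the source of the shift from
  -- `n + 1` to `n`.
  have e : (delta.adj : FormalOp R) = -(delta * shift.adj) := by
    ext j n
    rw [neg_apply, delta_mul_apply]
    change (if -j = 1 then (1 : R) else 0) - (if -j = 0 then 1 else 0) =
      -((if -(j - 1) = 1 then (1 : R) else 0) - if -j = 1 then 1 else 0)
    split_ifs <;> first | omega | simp
  have e2 : (deltaInvMinus * delta.adj : FormalOp R) = -shift.adj := by
    have hs := (isLaurent_shift (R := R)).adj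
    have h := mul_assoc_of_mem (suppLE_deltaInvMinus (R := R)).mem (isLaurent_delta 1) (hs 1)
    rw [deltaInvMinus_mul_delta, one_mul_eq] at h
    rw [e]
    exact (congrArg Subtype.val (mul_neg
      (⟨_, (suppLE_deltaInvMinus (R := R)).mem⟩ : oneSided R 1)
      (⟨_, ((isLaurent_delta (R := R)).mul hs) 1⟩ : oneSided R 1))).trans (congrArg Neg.neg h.symm)
  rw [adj_mul, ← mul_assoc_of_mem suppLE_deltaInvMinus.mem (isLaurent_delta.adj 1) (hC.adj 1), e2,
    (isLaurent_shift.adj.neg.mul hC.adj).act_mul isLaurent_delta, delta_act,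
    isLaurent_shift.adj.neg.act_mul hC.adj, neg_act]
  change -(∑ᶠ j : ℤ, (if -j = 1 then (1 : R) else 0) * _) = _
  rw [finsum_eq_single _ (-1) fun j hj => by rw [if_neg (by omega), zero_mul]]
  simp

/-! ### Truncations -/

theorem trunc_apply (P : ℤ → Prop) [DecidablePred P] (A : FormalOp R) (j n : ℤ) :
    trunc P A j n = if P j then A j n else 0 := rfl

theorem trunc_mem_oneSided (P : ℤ → Prop) [DecidablePred P] {s : ℤˣ} {A : FormalOp R}
    (hA : A ∈ oneSided R s) : trunc P A ∈ oneSided R s := by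
  obtain ⟨a, hA⟩ := hA
  exact ⟨a, fun j hj n => by rw [trunc_apply, hA j hj, ite_self]⟩

theorem isLaurent_trunc_le {A : FormalOp R} (hA : A ∈ oneSided R 1) (k : ℤ) :
    IsLaurent (trunc (k ≤ ·) A) := by
  intro s
  rcases Int.units_eq_one_or s with rfl | rfl
  · exact trunc_mem_oneSided _ hA
  · refine ⟨-k, fun j hj n => if_neg ?_⟩
    simp only [Units.val_neg, Units.val_one] at hj
    omega

theorem isLaurent_trunc_lt {A : FormalOp R} (hA : A ∈ oneSided R (-1)) (k : ℤ) :
    IsLaurent (trunc (· < k) A) := by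
  intro s
  rcases Int.units_eq_one_or s with rfl | rfl
  · refine ⟨k, fun j hj n => if_neg ?_⟩
    simp only [Units.val_one] at hj
    omega
  · exact trunc_mem_oneSided _ hA

theorem isLaurent_deltaTrunc {A : FormalOp R} (hA : A ∈ oneSided R 1) :
    IsLaurent (deltaTrunc A) := (isLaurent_trunc_le hA 1).sub (isLaurent_mulOp _)

theorem isLaurent_deltaStarTrunc {A : FormalOp R} (hA : A ∈ oneSided R (-1)) :
    IsLaurent (deltaStarTrunc A) := (isLaurent_trunc_lt hA 0).sub (isLaurent_mulOp _)

theorem deltaTrunc_act_one {A : FormalOp R} (hA : A ∈ oneSided R 1) :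
    (deltaTrunc A).act 1 = 0 := by
  rw [deltaTrunc, (isLaurent_trunc_le hA 1).sub_act (isLaurent_mulOp _)]
  funext n
  simp [mulOp_act]

theorem deltaStarTrunc_act_one {A : FormalOp R} (hA : A ∈ oneSided R (-1)) :
    (deltaStarTrunc A).act 1 = 0 := by
  rw [deltaStarTrunc, (isLaurent_trunc_lt hA 0).sub_act (isLaurent_mulOp _)]
  funext n
  simp [mulOp_act]

theorem deltaTrunc_eq_ite (A : FormalOp R) (j n : ℤ) :
    deltaTrunc A j n =
      (if 1 ≤ j then A j n else 0) - if j = 0 then (trunc (1 ≤ ·) A).act 1 n else 0 := rfl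

theorem deltaStarTrunc_eq_ite (A : FormalOp R) (j n : ℤ) :
    deltaStarTrunc A j n =
      (if j < 0 then A j n else 0) - if j = 0 then (trunc (· < 0) A).act 1 n else 0 := rfl

theorem suppLE_deltaTrunc (A : FormalOp R) : SuppLE (-1) 0 (deltaTrunc A) := by
  intro j hj n
  simp only [Units.val_neg, Units.val_one] at hj
  rw [deltaTrunc_eq_ite, if_neg (by omega), if_neg (by omega), sub_zero]

theorem suppLE_deltaStarTrunc (A : FormalOp R) : SuppLE 1 0 (deltaStarTrunc A) := by
  intro j hj n
  simp only [Units.val_one] at hj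
  rw [deltaStarTrunc_eq_ite, if_neg (by omega), if_neg (by omega), sub_zero]

/-- The difference between `A_{≥0}` and `A_{Δ,≥1}`. -/
noncomputable def deltaDefect (A : FormalOp R) : ℤ → R :=
  fun n => A 0 n + (trunc (1 ≤ ·) A).act 1 n

/-- The difference between `A_{<0}` and `A_{Δ^*,≥1}`. -/
noncomputable def deltaStarDefect (A : FormalOp R) : ℤ → R := (trunc (· < 0) A).act 1

theorem trunc_nonneg_eq (A : FormalOp R) :
    trunc (0 ≤ ·) A = deltaTrunc A + mulOp (deltaDefect A) := by
  ext j n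
  rw [add_apply, deltaTrunc_eq_ite, mulOp_apply, trunc_apply, deltaDefect]
  rcases lt_trichotomy j 0 with h | rfl | h
  · simp only [if_neg (show ¬0 ≤ j by omega), if_neg (show ¬1 ≤ j by omega), if_neg h.ne]
    ring
  · simp
  · simp only [if_pos (show 0 ≤ j by omega), if_pos (show 1 ≤ j by omega), if_neg h.ne']
    ring

theorem trunc_neg_eq (A : FormalOp R) :
    trunc (· < 0) A = deltaStarTrunc A + mulOp (deltaStarDefect A) := by
  ext j n
  rw [add_apply, deltaStarTrunc_eq_ite, mulOp_apply, trunc_apply, deltaStarDefect]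
  ring

theorem suppLE_sub_deltaTrunc (A : FormalOp R) : SuppLE 1 0 (A - deltaTrunc A) := by
  intro j hj n
  simp only [Units.val_one] at hj
  rw [sub_apply, deltaTrunc_eq_ite, if_pos (by omega), if_neg (by omega), sub_zero, sub_self]

theorem sub_deltaTrunc_zero (A : FormalOp R) (n : ℤ) :
    (A - deltaTrunc A) 0 n = deltaDefect A n := by
  rw [sub_apply, deltaTrunc_eq_ite, deltaDefect]
  simp

theorem suppLE_sub_deltaStarTrunc (A : FormalOp R) : SuppLE (-1) 0 (A - deltaStarTrunc A) := by
  intro j hj n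
  simp only [Units.val_neg, Units.val_one] at hj
  rw [sub_apply, deltaStarTrunc_eq_ite, if_pos (by omega), if_neg (by omega), sub_zero, sub_self]

theorem deltaStarTrunc_zero (A : FormalOp R) (n : ℤ) :
    deltaStarTrunc A 0 n = -deltaStarDefect A n := by
  rw [deltaStarTrunc_eq_ite, deltaStarDefect]
  simp

theorem trunc_mulOp_mul_mulOp (P : ℤ → Prop) [DecidablePred P] (u v : ℤ → R) (A : FormalOp R) :
    trunc P (mulOp u * A * mulOp v) = mulOp u * trunc P A * mulOp v := by
  ext j n
  rw [trunc_apply, mul_mulOp_apply, mul_mulOp_apply, mulOp_mul_apply, mulOp_mul_apply, trunc_apply]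
  split_ifs <;> simp

/-- Split `A = B + E` with `B = A_{Δ,≥1}`. Since `B(1) = 0`, `B Δ⁻¹` has only nonnegative degrees
and so does `Δ B Δ⁻¹`. The remainder `E` has degrees at most `0` with top coefficient the defect, so
`Δ E Δ⁻¹` contributes only that coefficient, shifted by one, to the truncation. -/
theorem trunc_nonneg_delta_conj {A : FormalOp R} (hA : A ∈ oneSided R 1) :
    trunc (0 ≤ ·) (delta * A * deltaInvMinus) =
      delta * (deltaTrunc A * deltaInvMinus) + mulOp (shiftFun (deltaDefect A)) := by
  have hB := isLaurent_deltaTrunc hA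
  have hE := suppLE_sub_deltaTrunc A
  have hEm := hE.mul (suppLE_deltaInvMinus (R := R))
  have hY : A * deltaInvMinus =
      deltaTrunc A * deltaInvMinus + (A - deltaTrunc A) * deltaInvMinus := by
    rw [← hB.compat_left.add_mul (hE.compat suppLE_deltaInvMinus), add_sub_cancel]
  have hlead : ∀ n, ((A - deltaTrunc A) * deltaInvMinus : FormalOp R) (-1) n =
      deltaDefect A n := fun n => by
    have h := hE.mul_apply_extremal (suppLE_deltaInvMinus (R := R)) n
    simp only [Units.val_one, mul_zero, zero_add, mul_neg, mul_one] at h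
    rw [h, sub_deltaTrunc_zero]
    simp [deltaInvMinus]
  have hC : ∀ j, j < 0 → ∀ n, (deltaTrunc A * deltaInvMinus : FormalOp R) j n = 0 := by
    intro j hj n
    -- Passing to the other expansion makes the lower bound on the degrees visible.
    rw [hB.mul_deltaInv (deltaTrunc_act_one hA)]
    refine (suppLE_deltaTrunc A).mul suppLE_deltaInvPlus j ?_ n
    simp only [Units.val_neg, Units.val_one]
    omega
  have hE0 : ∀ j, 0 ≤ j → ∀ n, ((A - deltaTrunc A) * deltaInvMinus : FormalOp R) j n = 0 :=
    fun j hj => hEm j (by simp only [Units.val_one]; omega)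
  rw [mul_assoc_of_mem (isLaurent_delta 1) hA suppLE_deltaInvMinus.mem, hY]
  ext j n
  rw [trunc_apply, add_apply, mulOp_apply, delta_mul_apply, delta_mul_apply, add_apply, add_apply]
  rcases lt_trichotomy j 0 with h | rfl | h
  · rw [if_neg (by omega), if_neg (by omega), hC _ (by omega), hC _ h]
    simp
  · rw [if_pos le_rfl, if_pos rfl, zero_sub, hlead, hE0 _ le_rfl, hC _ (by omega), shiftFun]
    ring
  · rw [if_pos (by omega), if_neg (by omega), hE0 _ (by omega), hE0 _ (by omega)]
    ring

/-- Here `E = A - A_{Δ^*,≥1}` has nonnegative degrees, and so does `Δ E Δ⁻¹`, which the truncation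
discards. The operator `Δ B Δ⁻¹` has degrees at most `0`; its degree-zero coefficient is minus the
shifted defect, which the added function cancels. -/
theorem trunc_neg_delta_conj {A : FormalOp R} (hA : A ∈ oneSided R (-1)) :
    trunc (· < 0) (delta * A * deltaInvPlus) =
      delta * (deltaStarTrunc A * deltaInvMinus) + mulOp (shiftFun (deltaStarDefect A)) := by
  have hB := isLaurent_deltaStarTrunc hA
  have hE := suppLE_sub_deltaStarTrunc A
  have hEm := hE.mul (suppLE_deltaInvPlus (R := R))
  have hY : A * deltaInvPlus =
      deltaStarTrunc A * deltaInvMinus + (A - deltaStarTrunc A) * deltaInvPlus := by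
    rw [hB.mul_deltaInv (deltaStarTrunc_act_one hA),
      ← hB.compat_left.add_mul (hE.compat suppLE_deltaInvPlus), add_sub_cancel]
  have hlead : ∀ n, (deltaStarTrunc A * deltaInvMinus : FormalOp R) (-1) n =
      -deltaStarDefect A n := fun n => by
    have h := (suppLE_deltaStarTrunc A).mul_apply_extremal (suppLE_deltaInvMinus (R := R)) n
    simp only [Units.val_one, mul_zero, zero_add, mul_neg, mul_one] at h
    rw [h, deltaStarTrunc_zero]
    simp [deltaInvMinus]
  have hC : ∀ j, 0 ≤ j → ∀ n, (deltaStarTrunc A * deltaInvMinus : FormalOp R) j n = 0 :=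
    fun j hj => (suppLE_deltaStarTrunc A).mul suppLE_deltaInvMinus j
      (by simp only [Units.val_one]; omega)
  have hE0 : ∀ j, j < 0 → ∀ n, ((A - deltaStarTrunc A) * deltaInvPlus : FormalOp R) j n = 0 :=
    fun j hj => hEm j (by simp only [Units.val_neg, Units.val_one]; omega)
  rw [mul_assoc_of_mem (isLaurent_delta _) hA suppLE_deltaInvPlus.mem, hY]
  ext j n
  rw [trunc_apply, add_apply, mulOp_apply, delta_mul_apply, delta_mul_apply, add_apply, add_apply]
  rcases lt_trichotomy j 0 with h | rfl | h
  · rw [if_pos h, if_neg (by omega), hE0 _ h, hE0 _ (by omega)]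
    ring
  · rw [if_neg (by omega), if_pos rfl, zero_sub, hlead, hC _ le_rfl, shiftFun]
    ring
  · rw [if_neg (by omega), if_neg (by omega), hC _ (by omega), hC _ (by omega)]
    simp

/-! ### Gauge transformations -/

theorem gauge_lax {𝓐 : Type*} [Ring 𝓐] (δ : 𝓐 → 𝓐)
    (hδ : ∀ x y, δ (x * y) = δ x * y + x * δ y) {T T' L B B' : 𝓐} (h : T' * T = 1)
    (h' : T * T' = 1) (hB : B' * T = T * B + δ T) (hL : δ L = B * L - L * B) :
    δ (T * L * T') = B' * (T * L * T') - T * L * T' * B' := by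
  have e : T * L * T' * T = T * L := by rw [mul_assoc, h, mul_one]
  -- Differentiating `(T L T') T = T L` avoids ever computing `δ T'`.
  have e1 := hδ (T * L * T') T
  rw [e, hδ, hL] at e1
  have e2 : δ (T * L * T') * T = (B' * (T * L * T') - T * L * T' * B') * T := by
    calc δ (T * L * T') * T = δ T * L + T * (B * L - L * B) - T * L * T' * δ T := by
          rw [e1, add_sub_cancel_right]
      _ = (T * B + δ T) * L - (T * L * (T' * T) * B + T * L * T' * δ T) := by
          rw [h]; noncomm_ring
      _ = (T * B + δ T) * L - T * L * T' * (T * B + δ T) := by noncomm_ring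
      _ = _ := by rw [← hB, sub_mul, mul_assoc B' _ T, e]; noncomm_ring
  calc _ = δ (T * L * T') * T * T' := by rw [mul_assoc _ T T', h', mul_one]
    _ = _ := by rw [e2, mul_assoc, h', mul_one]

section conj

variable {s : ℤˣ} {T T' L B B' : FormalOp R}

theorem derivOp_conj {K : Type*} [CommRing K] [Algebra K R] (D : Derivation K R R)
    (hT : T ∈ oneSided R s) (hT' : T' ∈ oneSided R s) (hL : L ∈ oneSided R s)
    (hB : B ∈ oneSided R s) (hB' : B' ∈ oneSided R s) (h : T' * T = 1) (h' : T * T' = 1)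
    (hBB' : B' * T = T * B + derivOp D T) (hlax : derivOp D L = B * L - L * B) :
    derivOp D (T * L * T') = B' * (T * L * T') - T * L * T' * B' := by
  have := gauge_lax (derivOneSided D s) (derivOneSided_mul D) (T := ⟨T, hT⟩) (T' := ⟨T', hT'⟩)
    (L := ⟨L, hL⟩) (B := ⟨B, hB⟩) (B' := ⟨B', hB'⟩) (Subtype.ext h) (Subtype.ext h')
    (Subtype.ext hBB') (Subtype.ext hlax)
  exact congrArg Subtype.val this

theorem conj_pow_of_mem (hT : T ∈ oneSided R s) (hT' : T' ∈ oneSided R s)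
    (hL : L ∈ oneSided R s) (h : T' * T = 1) (h' : T * T' = 1) (k : ℕ) :
    (T * L * T') ^ k = T * L ^ k * T' := by
  let t : (oneSided R s)ˣ := ⟨⟨T, hT⟩, ⟨T', hT'⟩, Subtype.ext h', Subtype.ext h⟩
  have e := Units.conj_pow t (⟨L, hL⟩ : oneSided R s) k
  have e' := congrArg Subtype.val e
  rw [coe_pow_oneSided] at e'
  refine e'.trans ?_
  rw [coe_mul_oneSided, coe_mul_oneSided, coe_pow_oneSided]
  rfl

end conj

end FormalOp
end MiuraToda

namespace MiuraToda

open FormalOp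

/-! ### Toda versus modified Toda operators, the gauge principle, and the evolution of `c₀`. -/

section Defect

variable {R : Type*} [CommRing R]

/-- The difference between the Toda operator `𝓑` and the modified Toda operator `B`. -/
noncomputable def todaDefect (L₁ L₂ : FormalOp R) (a : Fin 2) (p : ℕ) : ℤ → R :=
  if a = 0 then deltaDefect (L₁ ^ p) else deltaStarDefect (L₂ ^ p)

theorem todaB_eq (L₁ L₂ : FormalOp R) (a : Fin 2) (p : ℕ) :
    todaB L₁ L₂ a p = mTodaB L₁ L₂ a p + mulOp (todaDefect L₁ L₂ a p) := by
  unfold todaB mTodaB todaDefect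
  split_ifs
  · exact trunc_nonneg_eq _
  · exact trunc_neg_eq _

theorem mulOp_mul_mulOp (f g : ℤ → R) : mulOp f * mulOp g = mulOp (f * g) := by
  ext j n
  rw [mulOp_mul_apply, mulOp_apply, mulOp_apply, mul_ite, mul_zero]
  rfl

theorem cInvFun_mul_cFun (c₀ : ℤ → Rˣ) : cInvFun c₀ * cFun c₀ = 1 :=
  funext fun n => Units.inv_mul (c₀ n)

theorem cFun_mul_cInvFun (c₀ : ℤ → Rˣ) : cFun c₀ * cInvFun c₀ = 1 :=
  funext fun n => Units.mul_inv (c₀ n)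

end Defect

section Miura

variable {R : Type*} [CommRing R] [Algebra ℂ R] {D : Fin 2 → ℕ → Derivation ℂ R R} {M N m : ℕ}
  {L₁ L₂ S : FormalOp R} {c₀ : ℤ → Rˣ} {q r : Fin m → ℤ → R}

namespace IsGBMT

variable (hL : IsGBMT D M N L₁ L₂ q r)
include hL

theorem suppLE₁ : SuppLE 1 1 L₁ := fun j hj => hL.shape₁ j (by simpa using hj)

theorem suppLE₂ : SuppLE (-1) 1 L₂ := fun j hj => hL.shape₂ j (by
  simp only [Units.val_neg, Units.val_one] at hj
  omega)

theorem pow_mem₁ (p : ℕ) : L₁ ^ p ∈ oneSided R 1 := pow_mem_oneSided hL.suppLE₁.mem p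

theorem pow_mem₂ (p : ℕ) : L₂ ^ p ∈ oneSided R (-1) := pow_mem_oneSided hL.suppLE₂.mem p

theorem isLaurent_mTodaB (a : Fin 2) (p : ℕ) : IsLaurent (mTodaB L₁ L₂ a p) := by
  unfold mTodaB
  split_ifs
  · exact isLaurent_deltaTrunc (hL.pow_mem₁ p)
  · exact isLaurent_deltaStarTrunc (hL.pow_mem₂ p)

theorem mTodaB_act_one (a : Fin 2) (p : ℕ) : (mTodaB L₁ L₂ a p).act 1 = 0 := by
  unfold mTodaB
  split_ifs
  · exact deltaTrunc_act_one (hL.pow_mem₁ p)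
  · exact deltaStarTrunc_act_one (hL.pow_mem₂ p)

/-- A gauge transformation of a GBMT solution by a Laurent polynomial `T`, invertible on both
sides, under which the operators `B` become Toda operators, gives a GBT solution. -/
theorem isGBT_of_gauge {T TM TP : FormalOp R} {r' : Fin m → ℤ → R} (hT : IsLaurent T)
    (hTM : TM ∈ oneSided R 1) (hTP : TP ∈ oneSided R (-1)) (hM : TM * T = 1) (hM' : T * TM = 1)
    (hP : TP * T = 1) (hP' : T * TP = 1)
    (shape₁ : SuppLE 1 1 (T * L₁ * TM)) (lead₁ : ∀ n, (T * L₁ * TM) 1 n = 1)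
    (shape₂ : SuppLE (-1) 1 (T * L₂ * TP)) (lead₂ : ∀ n, IsUnit ((T * L₂ * TP) (-1) n))
    (constraint : T * L₁ ^ M * TM = T * L₂ ^ N * TP + ∑ i, bilateral (T.act (q i)) (r' i))
    (hB : ∀ a p, 1 ≤ p → IsLaurent (todaB (T * L₁ * TM) (T * L₂ * TP) a p))
    (gauge : ∀ a p, 1 ≤ p → todaB (T * L₁ * TM) (T * L₂ * TP) a p * T =
      T * mTodaB L₁ L₂ a p + derivOp (D a p) T)
    (adjEigen : ∀ i a p, 1 ≤ p → ∀ n,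
      D a p (r' i n) = -((todaB (T * L₁ * TM) (T * L₂ * TP) a p).adj.act (r' i) n)) :
    IsGBT D M N (T * L₁ * TM) (T * L₂ * TP) (fun i => T.act (q i)) r' where
  shape₁ j hj := shape₁ j (by simpa using hj)
  lead₁ := lead₁
  shape₂ j hj := shape₂ j (by simp only [Units.val_neg, Units.val_one]; omega)
  lead₂ := lead₂
  constraint := by
    rw [conj_pow_of_mem (hT 1) hTM hL.suppLE₁.mem hM hM',
      conj_pow_of_mem (hT (-1)) hTP hL.suppLE₂.mem hP hP', constraint]
  lax₁ a p hp := derivOp_conj (D a p) (hT 1) hTM hL.suppLE₁.mem (hL.isLaurent_mTodaB a p 1)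
    (hB a p hp 1) hM hM' (gauge a p hp) (hL.lax₁ a p hp)
  lax₂ a p hp := derivOp_conj (D a p) (hT (-1)) hTP hL.suppLE₂.mem
    (hL.isLaurent_mTodaB a p (-1)) (hB a p hp (-1)) hP hP' (gauge a p hp) (hL.lax₂ a p hp)
  eigen i a p hp n := by
    have hdT : IsLaurent (derivOp (D a p) T) := fun s => (derivOneSided (D a p) s ⟨T, hT s⟩).2
    -- `∂(T(q)) = (∂T)(q) + T(B(q)) = (𝓑 T)(q) = 𝓑(T(q))`.
    rw [hT.deriv_act, ← (hB a p hp).act_mul hT, gauge a p hp,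
      (hT.mul (hL.isLaurent_mTodaB a p)).add_act hdT, hT.act_mul (hL.isLaurent_mTodaB a p),
      funext (hL.eigen i a p hp), Pi.add_apply, add_comm]
  adjEigen := adjEigen

/-- Shifting by one absorbs the nonlocal factor in the equation for `r`; this form serves both
transformations. -/
theorem deriv_r (i : Fin m) (a : Fin 2) (p : ℕ) (hp : 1 ≤ p) (n : ℤ) :
    D a p (r i (n + 1)) =
      (mTodaB L₁ L₂ a p * deltaInvMinus).adj.act (deltaFun (r i)) n := by
  have hB := hL.isLaurent_mTodaB a p
  have h := (hB.isLaurent_mul_deltaInv (hL.mTodaB_act_one a p)).deltaInv_adj_delta_act (r i) n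
  rw [hB.mul_deltaInv_mul_delta] at h
  rw [hL.adjEigen i a p hp, h, neg_neg]

end IsGBMT

/-- The evolution of `c₀`. -/
theorem IsWaveOp.deriv_c (hS : IsWaveOp D L₁ L₂ S c₀) (hL : IsGBMT D M N L₁ L₂ q r)
    (a : Fin 2) (p : ℕ) (hp : 1 ≤ p) (n : ℤ) :
    D a p (c₀ n : R) = -(todaDefect L₁ L₂ a p n * c₀ n) := by
  have hSs : SuppLE 1 0 S := fun j hj => hS.shape j (by simpa using hj)
  rw [← hS.lead]
  obtain rfl | rfl : a = 0 ∨ a = 1 := by omega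
  · obtain ⟨S', hs', h1, h2, h3⟩ := hS.dressing
    have hs : SuppLE 1 0 S' := fun j hj => hs' j (by simpa using hj)
    have hpow : L₁ ^ p * S = S * shift ^ p := by
      rw [h3, conj_pow_of_mem hSs.mem hs.mem (isLaurent_shift 1) h2 h1,
        mul_assoc_of_mem (mul_mem_oneSided hSs.mem (pow_mem_oneSided (isLaurent_shift 1) p))
          hs.mem hSs.mem, h2, mul_one_eq]
    -- Since `S Λ^p = L₁^p S`, the wave equation reads `∂S = -(L₁^p - B) S`; the factor `L₁^p - B`
    -- has degrees at most `0` and the defect as top coefficient.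
    have e : derivOp (D 0 p) S = -((L₁ ^ p - deltaTrunc (L₁ ^ p)) * S) := by
      rw [hS.evol₁ p hp, ← hpow]
      have := congrArg Subtype.val (sub_mul (⟨_, hL.pow_mem₁ p⟩ : oneSided R 1)
        ⟨_, isLaurent_deltaTrunc (hL.pow_mem₁ p) 1⟩ ⟨S, hSs.mem⟩)
      refine Eq.trans ?_ (congrArg Neg.neg this.symm)
      exact (neg_sub _ _).symm
    change derivOp (D 0 p) S 0 n = _
    have h := (suppLE_sub_deltaTrunc (L₁ ^ p)).mul_apply_extremal hSs n
    simp only [Units.val_one, add_zero, mul_zero] at h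
    rw [e, FormalOp.neg_apply, h, sub_deltaTrunc_zero]
    rfl
  -- For the second flows `B` itself has degrees at most `0`, and its degree-zero coefficient is
  -- minus the defect.
  · change derivOp (D 1 p) S 0 n = _
    have h := (suppLE_deltaStarTrunc (L₂ ^ p)).mul_apply_extremal hSs n
    simp only [Units.val_one, add_zero, mul_zero] at h
    rw [hS.evol₂ p hp]
    refine h.trans ?_
    rw [deltaStarTrunc_zero, neg_mul]
    rfl

theorem IsWaveOp.deriv_c_inv (hS : IsWaveOp D L₁ L₂ S c₀) (hL : IsGBMT D M N L₁ L₂ q r)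
    (a : Fin 2) (p : ℕ) (hp : 1 ≤ p) (n : ℤ) :
    D a p (((c₀ n)⁻¹ : Rˣ) : R) = ((c₀ n)⁻¹ : Rˣ) * todaDefect L₁ L₂ a p n := by
  rw [(D a p).leibniz_of_mul_eq_one (Units.inv_mul (c₀ n)), hS.deriv_c hL a p hp, smul_eq_mul]
  have := Units.inv_mul (c₀ n)
  linear_combination (((c₀ n)⁻¹ : Rˣ) : R) * todaDefect L₁ L₂ a p n * this

/-- The leading coefficient of `L₁ = S Λ S⁻¹`. -/
theorem IsWaveOp.lead₁ (hS : IsWaveOp D L₁ L₂ S c₀) (n : ℤ) :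
    L₁ 1 n = c₀ n * ((c₀ (n + 1))⁻¹ : Rˣ) := by
  obtain ⟨S', hs', h1, -, h3⟩ := hS.dressing
  have hSs : SuppLE 1 0 S := fun j hj => hS.shape j (by simpa using hj)
  have hs : SuppLE 1 0 S' := fun j hj => hs' j (by simpa using hj)
  have hsh : SuppLE 1 1 (shift : FormalOp R) := fun j hj n =>
    if_neg (by simp only [Units.val_one] at hj; omega)
  have e1 := hSs.mul_apply_extremal hsh n
  have e2 := (hSs.mul hsh).mul_apply_extremal hs n
  have e3 := hSs.mul_apply_extremal hs (n + 1)
  simp only [Units.val_one, add_zero, zero_add, mul_zero, mul_one] at e1 e2 e3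
  have e4 : (1 : FormalOp R) 0 (n + 1) = 1 := rfl
  rw [h1, e4, hS.lead] at e3
  -- Degree zero of `S S' = 1` identifies the leading coefficient of `S'`.
  have e5 : S' 0 (n + 1) = ((c₀ (n + 1))⁻¹ : Rˣ) := by
    rw [← Units.inv_mul_cancel_left (c₀ (n + 1)) (S' 0 (n + 1)), ← e3, mul_one]
  rw [h3, e2, e1, hS.lead, e5]
  simp [shift]

theorem derivOp_mulOp (D : Derivation ℂ R R) (f : ℤ → R) :
    derivOp D (mulOp f) = mulOp fun n => D (f n) := by
  ext j n
  change D (if j = 0 then f n else 0) = if j = 0 then D (f n) else 0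
  split_ifs <;> simp

end Miura

/-! ### Inverses of the gauge operators `T₁` and `T₂`. -/

section Inverses

variable {R : Type*} [CommRing R] (c₀ : ℤ → Rˣ)

theorem T₁Inv_mul_T₁ : T₁Inv c₀ * T₁ c₀ = 1 := by
  rw [T₁Inv, T₁, mulOp_mul_mulOp, cFun_mul_cInvFun]
  rfl

theorem T₁_mul_T₁Inv : T₁ c₀ * T₁Inv c₀ = 1 := by
  rw [T₁Inv, T₁, mulOp_mul_mulOp, cInvFun_mul_cFun]
  rfl

theorem mulOp_shiftFun_cFun_mul :
    mulOp (shiftFun (cFun c₀)) * mulOp (shiftFun (cInvFun c₀)) = 1 := by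
  rw [mulOp_mul_mulOp]
  exact congrArg mulOp (congrArg shiftFun (cFun_mul_cInvFun c₀))

theorem mulOp_shiftFun_cInvFun_mul :
    mulOp (shiftFun (cInvFun c₀)) * mulOp (shiftFun (cFun c₀)) = 1 := by
  rw [mulOp_mul_mulOp]
  exact congrArg mulOp (congrArg shiftFun (cInvFun_mul_cFun c₀))

theorem isLaurent_T₁ : IsLaurent (T₁ c₀) := isLaurent_mulOp _

theorem isLaurent_T₁Inv : IsLaurent (T₁Inv c₀) := isLaurent_mulOp _

theorem isLaurent_T₂ : IsLaurent (T₂ c₀) := (isLaurent_mulOp _).mul isLaurent_delta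

theorem T₂_inverse {s : ℤˣ} {E : FormalOp R} (hE : E ∈ oneSided R s) (h : delta * E = 1)
    (h' : E * delta = 1) :
    T₂ c₀ * (E * mulOp (shiftFun (cFun c₀))) = 1 ∧
      E * mulOp (shiftFun (cFun c₀)) * T₂ c₀ = 1 := by
  let u : (oneSided R s)ˣ := ⟨⟨_, mulOp_mem_oneSided (shiftFun (cInvFun c₀))⟩,
    ⟨_, mulOp_mem_oneSided (shiftFun (cFun c₀))⟩, Subtype.ext (mulOp_shiftFun_cInvFun_mul c₀),
    Subtype.ext (mulOp_shiftFun_cFun_mul c₀)⟩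
  let d : (oneSided R s)ˣ := ⟨⟨_, isLaurent_delta s⟩, ⟨E, hE⟩, Subtype.ext h, Subtype.ext h'⟩
  exact ⟨congrArg Subtype.val (u * d).mul_inv, congrArg Subtype.val (u * d).inv_mul⟩

/-- This isolates conjugation by `Δ`, the only part that interacts with truncation; the outer
functions pass through it. -/
theorem T₂_conj {s : ℤˣ} {E A : FormalOp R} (hE : E ∈ oneSided R s) (hA : A ∈ oneSided R s) :
    T₂ c₀ * A * (E * mulOp (shiftFun (cFun c₀))) =
      mulOp (shiftFun (cInvFun c₀)) * (delta * A * E) * mulOp (shiftFun (cFun c₀)) := by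
  have hu := mulOp_mem_oneSided (s := s) (shiftFun (cInvFun c₀))
  have hv := mulOp_mem_oneSided (s := s) (shiftFun (cFun c₀))
  have hd := isLaurent_delta (R := R) s
  rw [T₂, mul_assoc_of_mem hu hd hA, ← mul_assoc_of_mem (mul_mem_oneSided hu
    (mul_mem_oneSided hd hA)) hE hv, mul_assoc_of_mem hu (mul_mem_oneSided hd hA) hE]

theorem T₂InvMinus_mem : T₂InvMinus c₀ ∈ oneSided R 1 :=
  mul_mem_oneSided suppLE_deltaInvMinus.mem (mulOp_mem_oneSided _)

theorem T₂InvPlus_mem : T₂InvPlus c₀ ∈ oneSided R (-1) :=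
  mul_mem_oneSided suppLE_deltaInvPlus.mem (mulOp_mem_oneSided _)

theorem T₂_mul_T₂InvMinus : T₂ c₀ * T₂InvMinus c₀ = 1 :=
  (T₂_inverse c₀ suppLE_deltaInvMinus.mem delta_mul_deltaInvMinus deltaInvMinus_mul_delta).1

theorem T₂InvMinus_mul_T₂ : T₂InvMinus c₀ * T₂ c₀ = 1 :=
  (T₂_inverse c₀ suppLE_deltaInvMinus.mem delta_mul_deltaInvMinus deltaInvMinus_mul_delta).2

theorem T₂_mul_T₂InvPlus : T₂ c₀ * T₂InvPlus c₀ = 1 :=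
  (T₂_inverse c₀ suppLE_deltaInvPlus.mem delta_mul_deltaInvPlus deltaInvPlus_mul_delta).1

theorem T₂InvPlus_mul_T₂ : T₂InvPlus c₀ * T₂ c₀ = 1 :=
  (T₂_inverse c₀ suppLE_deltaInvPlus.mem delta_mul_deltaInvPlus deltaInvPlus_mul_delta).2

end Inverses

/-! ### The two Miura transformations. -/

section Miura

variable {R : Type*} [CommRing R] [Algebra ℂ R] {D : Fin 2 → ℕ → Derivation ℂ R R} {M N m : ℕ}
  {L₁ L₂ S : FormalOp R} {c₀ : ℤ → Rˣ} {q r : Fin m → ℤ → R}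

namespace IsGBMT

theorem todaB_T₁ (hL : IsGBMT D M N L₁ L₂ q r) (c₀ : ℤ → Rˣ) (a : Fin 2) (p : ℕ) :
    todaB (T₁ c₀ * L₁ * T₁Inv c₀) (T₁ c₀ * L₂ * T₁Inv c₀) a p =
      T₁ c₀ * (mTodaB L₁ L₂ a p + mulOp (todaDefect L₁ L₂ a p)) * T₁Inv c₀ := by
  rw [← todaB_eq, todaB, todaB,
    conj_pow_of_mem (isLaurent_T₁ c₀ _) (isLaurent_T₁Inv c₀ _) hL.suppLE₁.mem
      (T₁Inv_mul_T₁ c₀) (T₁_mul_T₁Inv c₀),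
    conj_pow_of_mem (isLaurent_T₁ c₀ _) (isLaurent_T₁Inv c₀ _) hL.suppLE₂.mem
      (T₁Inv_mul_T₁ c₀) (T₁_mul_T₁Inv c₀)]
  split_ifs <;> exact trunc_mulOp_mul_mulOp _ _ _ _

theorem todaB_T₂ (hL : IsGBMT D M N L₁ L₂ q r) (c₀ : ℤ → Rˣ) (a : Fin 2) (p : ℕ) :
    todaB (T₂ c₀ * L₁ * T₂InvMinus c₀) (T₂ c₀ * L₂ * T₂InvPlus c₀) a p =
      mulOp (shiftFun (cInvFun c₀)) * (delta * (mTodaB L₁ L₂ a p * deltaInvMinus) +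
        mulOp (shiftFun (todaDefect L₁ L₂ a p))) * mulOp (shiftFun (cFun c₀)) := by
  rw [todaB, conj_pow_of_mem (isLaurent_T₂ c₀ 1) (T₂InvMinus_mem c₀) hL.suppLE₁.mem
      (T₂InvMinus_mul_T₂ c₀) (T₂_mul_T₂InvMinus c₀),
    conj_pow_of_mem (isLaurent_T₂ c₀ (-1)) (T₂InvPlus_mem c₀) hL.suppLE₂.mem
      (T₂InvPlus_mul_T₂ c₀) (T₂_mul_T₂InvPlus c₀), T₂InvMinus, T₂InvPlus,
    T₂_conj c₀ suppLE_deltaInvMinus.mem (hL.pow_mem₁ p),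
    T₂_conj c₀ suppLE_deltaInvPlus.mem (hL.pow_mem₂ p), trunc_mulOp_mul_mulOp,
    trunc_mulOp_mul_mulOp, trunc_nonneg_delta_conj (hL.pow_mem₁ p),
    trunc_neg_delta_conj (hL.pow_mem₂ p), mTodaB, todaDefect]
  split_ifs <;> rfl

theorem isGBT_T₁ (hL : IsGBMT D M N L₁ L₂ q r) (hS : IsWaveOp D L₁ L₂ S c₀) :
    IsGBT D M N (T₁ c₀ * L₁ * T₁Inv c₀) (T₁ c₀ * L₂ * T₁Inv c₀)
      (fun i n => ((c₀ n)⁻¹ : Rˣ) * q i n) (fun i n => -(deltaFun (r i) n * c₀ n)) := by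
  have hT := isLaurent_T₁ c₀
  have hT' := isLaurent_T₁Inv c₀
  have hB a p := hL.isLaurent_mTodaB a p
  have hg a p : IsLaurent (mulOp (todaDefect L₁ L₂ a p)) := isLaurent_mulOp _
  have happ (A : FormalOp R) (j n : ℤ) : (T₁ c₀ * A * T₁Inv c₀) j n =
      ((c₀ n)⁻¹ : Rˣ) * A j n * c₀ (n + j) := by
    rw [T₁Inv, T₁, mul_mulOp_apply, mulOp_mul_apply]
    rfl
  have hq : (fun i n => (((c₀ n)⁻¹ : Rˣ) : R) * q i n) = fun i => (T₁ c₀).act (q i) := by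
    funext i n
    rw [T₁, mulOp_act]
    rfl
  rw [hq]
  refine hL.isGBT_of_gauge hT (hT' 1) (hT' (-1)) (T₁Inv_mul_T₁ c₀) (T₁_mul_T₁Inv c₀)
    (T₁Inv_mul_T₁ c₀) (T₁_mul_T₁Inv c₀) ?_ ?_ ?_ ?_ ?_ ?_ ?_ ?_
  · intro j hj n
    rw [happ, hL.suppLE₁ j hj, mul_zero, zero_mul]
  · intro n
    rw [happ, hS.lead₁, Units.inv_mul_cancel_left, Units.inv_mul]
  · intro j hj n
    rw [happ, hL.suppLE₂ j hj, mul_zero, zero_mul]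
  · intro n
    rw [happ]
    exact ((Units.isUnit _).mul (hL.lead₂ n)).mul (Units.isUnit _)
  -- Right multiplication by `Δ` removes both expansions of `Δ⁻¹`; on the bilateral terms it acts
  -- through `Δ^*(Λ r) = -Δ r`, whence the minus sign in the new adjoint eigenfunctions.
  · have h := congrArg (· * delta) hL.constraint
    beta_reduce at h
    rw [isLaurent_delta.compat_right.add_mul isLaurent_delta.compat_right,
      mul_assoc_of_mem (hL.pow_mem₁ M) suppLE_deltaInvMinus.mem (isLaurent_delta 1),
      mul_assoc_of_mem (hL.pow_mem₂ N) suppLE_deltaInvPlus.mem (isLaurent_delta (-1)),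
      deltaInvMinus_mul_delta, deltaInvPlus_mul_delta, mul_one_eq, mul_one_eq,
      isLaurent_delta.sum_mul] at h
    rw [h, hT.compat_left.mul_add hT.compat_left, hT'.compat_right.add_mul hT'.compat_right,
      hT.mul_sum, hT'.sum_mul]
    refine congrArg (T₁ c₀ * L₂ ^ N * T₁Inv c₀ + ·) (Finset.sum_congr rfl fun i _ => ?_)
    rw [isLaurent_delta.bilateral_mul, hT.mul_bilateral, hT'.bilateral_mul]
    congr 1
    funext n
    rw [T₁Inv, adj_mulOp, mulOp_act, adj_delta_act, shiftFun, shiftFun, deltaFun,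
      sub_add_cancel, cFun]
    ring
  · intro a p _
    rw [hL.todaB_T₁]
    exact (hT.mul ((hB a p).add (hg a p))).mul hT'
  · intro a p hp
    rw [hL.todaB_T₁, (hT.mul ((hB a p).add (hg a p))).mul_assoc hT', T₁Inv_mul_T₁, mul_one_eq,
      hT.compat_left.mul_add hT.compat_left, T₁, mulOp_mul_mulOp, derivOp_mulOp]
    congr 2
    exact funext fun n => (hS.deriv_c_inv hL a p hp n).symm
  · intro i a p hp n
    have hBg := (hB a p).add (hg a p)
    -- Factoring `B = (B Δ⁻¹) Δ` gives `B^*(Δr)(n) = ∂r(n) - ∂r(n+1)` by `deriv_r`.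
    have hB' : (mTodaB L₁ L₂ a p).adj =
        delta.adj * (mTodaB L₁ L₂ a p * deltaInvMinus).adj := by
      rw [← adj_mul, (hB a p).mul_deltaInv_mul_delta]
    have hC := ((hB a p).isLaurent_mul_deltaInv (hL.mTodaB_act_one a p)).adj
    have hr : (T₁ c₀).act (fun n => -(deltaFun (r i) n * c₀ n)) = -deltaFun (r i) := by
      funext n
      rw [T₁, mulOp_act, cInvFun, mul_neg, mul_comm, mul_assoc, Units.mul_inv, mul_one]
      rfl
    have e : (todaB (T₁ c₀ * L₁ * T₁Inv c₀) (T₁ c₀ * L₂ * T₁Inv c₀) a p).adj =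
        T₁Inv c₀ * ((mTodaB L₁ L₂ a p).adj + mulOp (todaDefect L₁ L₂ a p)) * T₁ c₀ := by
      rw [hL.todaB_T₁, adj_mul, adj_mul, adj_add, adj_mulOp, T₁, T₁Inv, adj_mulOp, adj_mulOp]
      exact (hT'.mul_assoc ((hB a p).adj.add (hg a p))).symm
    rw [e, (hT'.mul ((hB a p).adj.add (hg a p))).act_mul hT, hr,
      hT'.act_mul ((hB a p).adj.add (hg a p)), T₁Inv, mulOp_act, act_neg,
      (hB a p).adj.add_act (hg a p), hB', isLaurent_delta.adj.act_mul hC, Pi.neg_apply,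
      Pi.add_apply, mulOp_act, adj_delta_act, ← hL.deriv_r i a p hp, ← hL.deriv_r i a p hp,
      sub_add_cancel, map_neg, Derivation.leibniz, hS.deriv_c hL a p hp, cFun, deltaFun, map_sub,
      smul_eq_mul, smul_eq_mul]
    ring

theorem isGBT_T₂ (hL : IsGBMT D M N L₁ L₂ q r) (hS : IsWaveOp D L₁ L₂ S c₀) :
    IsGBT D M N (T₂ c₀ * L₁ * T₂InvMinus c₀) (T₂ c₀ * L₂ * T₂InvPlus c₀)
      (fun i n => ((c₀ (n + 1))⁻¹ : Rˣ) * deltaFun (q i) n)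
      (fun i n => c₀ (n + 1) * r i (n + 1)) := by
  have hu : IsLaurent (mulOp (shiftFun (cInvFun c₀))) := isLaurent_mulOp _
  have hv : IsLaurent (mulOp (shiftFun (cFun c₀))) := isLaurent_mulOp _
  have hT := isLaurent_T₂ c₀
  have hB a p := hL.isLaurent_mTodaB a p
  have hC a p := (hB a p).isLaurent_mul_deltaInv (hL.mTodaB_act_one a p)
  have hdC a p := isLaurent_delta.mul (hC a p)
  have hg a p : IsLaurent (mulOp (shiftFun (todaDefect L₁ L₂ a p))) := isLaurent_mulOp _
  have hdM := suppLE_deltaInvMinus (R := R)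
  have hdP := suppLE_deltaInvPlus (R := R)
  have hone (j n : ℤ) : (1 : FormalOp R) j n = if j = 0 then 1 else 0 := rfl
  have hd1 : SuppLE 1 1 (delta : FormalOp R) := by
    intro j hj n
    simp only [Units.val_one] at hj
    change (if j = 1 then (1 : R) else 0) - (if j = 0 then 1 else 0) = 0
    rw [if_neg (by omega), if_neg (by omega), sub_zero]
  have hd2 : SuppLE (-1) 0 (delta : FormalOp R) := by
    intro j hj n
    simp only [Units.val_neg, Units.val_one] at hj
    change (if j = 1 then (1 : R) else 0) - (if j = 0 then 1 else 0) = 0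
    rw [if_neg (by omega), if_neg (by omega), sub_zero]
  have happ (A : FormalOp R) (j n : ℤ) :
      (mulOp (shiftFun (cInvFun c₀)) * A * mulOp (shiftFun (cFun c₀))) j n =
      ((c₀ (n + 1))⁻¹ : Rˣ) * A j n * c₀ (n + j + 1) := by
    rw [mul_mulOp_apply, mulOp_mul_apply]
    rfl
  have hq : (fun i n => (((c₀ (n + 1))⁻¹ : Rˣ) : R) * deltaFun (q i) n) =
      fun i => (T₂ c₀).act (q i) := by
    funext i n
    rw [T₂, hu.act_mul isLaurent_delta, delta_act, mulOp_act]
    rfl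
  rw [hq]
  refine hL.isGBT_of_gauge hT (T₂InvMinus_mem c₀) (T₂InvPlus_mem c₀) (T₂InvMinus_mul_T₂ c₀)
    (T₂_mul_T₂InvMinus c₀) (T₂InvPlus_mul_T₂ c₀) (T₂_mul_T₂InvPlus c₀) ?_ ?_ ?_ ?_ ?_ ?_ ?_ ?_
  · intro j hj n
    rw [T₂InvMinus, T₂_conj c₀ hdM.mem hL.suppLE₁.mem, happ,
      (hd1.mul hL.suppLE₁).mul hdM j (by omega), mul_zero, zero_mul]
  · intro n
    have e1 := hd1.mul_apply_extremal hL.suppLE₁ n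
    have e2 := (hd1.mul hL.suppLE₁).mul_apply_extremal hdM n
    norm_num at e1 e2
    rw [T₂InvMinus, T₂_conj c₀ hdM.mem hL.suppLE₁.mem, happ, e2, e1, hS.lead₁]
    have e3 : (delta : FormalOp R) 1 n = 1 := by simp [delta, shift, hone]
    have e4 : (deltaInvMinus : FormalOp R) (-1) (n + 2) = 1 := if_pos le_rfl
    rw [e3, e4, one_mul, mul_one, Units.inv_mul_cancel_left, Units.inv_mul]
  · intro j hj n
    rw [T₂InvPlus, T₂_conj c₀ hdP.mem hL.suppLE₂.mem, happ,
      (hd2.mul hL.suppLE₂).mul hdP j (by omega), mul_zero, zero_mul]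
  · intro n
    have e1 := hd2.mul_apply_extremal hL.suppLE₂ n
    have e2 := (hd2.mul hL.suppLE₂).mul_apply_extremal hdP n
    norm_num at e1 e2
    rw [T₂InvPlus, T₂_conj c₀ hdP.mem hL.suppLE₂.mem, happ, e2, e1]
    have e3 : (delta : FormalOp R) 0 n = -1 := by simp [delta, shift, hone]
    have e4 : (deltaInvPlus : FormalOp R) 0 (n + -1) = -1 := if_pos le_rfl
    -- The lowest coefficients of `Δ` and of `ι_Λ Δ⁻¹` are both `-1`, so the signs cancel and
    -- invertibility is that of the lowest coefficient of `L₂`.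
    rw [e3, e4]
    exact ((Units.isUnit _).mul ((isUnit_one.neg.mul (hL.lead₂ n)).mul isUnit_one.neg)).mul
      (Units.isUnit _)
  -- The constraint already carries `Δ⁻¹` on the right in the matching expansions, so it is
  -- multiplied by `T₂` on the left and `c₀(n+1)` on the right.
  · rw [T₂InvMinus, T₂InvPlus, ← mul_assoc_of_mem (mul_mem_oneSided (hT 1) (hL.pow_mem₁ M)) hdM.mem
      (hv 1), ← mul_assoc_of_mem (mul_mem_oneSided (hT (-1)) (hL.pow_mem₂ N)) hdP.mem (hv (-1)),
      mul_assoc_of_mem (hT 1) (hL.pow_mem₁ M) hdM.mem,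
      mul_assoc_of_mem (hT (-1)) (hL.pow_mem₂ N) hdP.mem, hL.constraint,
      hT.compat_left.mul_add hT.compat_left, hv.compat_right.add_mul hv.compat_right,
      hT.mul_sum, hv.sum_mul]
    refine congrArg (T₂ c₀ * (L₂ ^ N * deltaInvPlus) * mulOp (shiftFun (cFun c₀)) + ·)
      (Finset.sum_congr rfl fun i _ => ?_)
    rw [hT.mul_bilateral, hv.bilateral_mul, adj_mulOp]
    congr 1
    funext n
    rw [mulOp_act]
    rfl
  · intro a p _
    rw [hL.todaB_T₂]
    exact (hu.mul ((hdC a p).add (hg a p))).mul hv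
  · intro a p hp
    rw [hL.todaB_T₂, T₂, (hu.mul ((hdC a p).add (hg a p))).mul_assoc hv,
      ← hv.mul_assoc hu, mulOp_shiftFun_cFun_mul, one_mul_eq,
      hu.mul_assoc ((hdC a p).add (hg a p)),
      isLaurent_delta.compat_right.add_mul isLaurent_delta.compat_right,
      isLaurent_delta.mul_assoc (hC a p), (hB a p).mul_deltaInv_mul_delta,
      hu.compat_left.mul_add hu.compat_left, hu.mul_assoc isLaurent_delta,
      hu.compat_left.derivOp_mul, ← hu.mul_assoc (hg a p), mulOp_mul_mulOp, derivOp_mulOp]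
    -- `Δ` has constant coefficients, so only the factor `c₀⁻¹(n+1)` of `T₂` contributes to `∂T₂`.
    have e : derivOp (D a p) (delta : FormalOp R) = 0 := by
      ext j n
      change D a p ((if j = 1 then (1 : R) else 0) - (if j = 0 then 1 else 0)) = 0
      split_ifs <;> simp
    have e' : mulOp (shiftFun (cInvFun c₀)) * (0 : FormalOp R) = 0 := by
      ext j n
      rw [mulOp_mul_apply, FormalOp.zero_apply, mul_zero]
    rw [e, e', add_zero]
    congr 3
    exact funext fun n => (hS.deriv_c_inv hL a p hp (n + 1)).symm
  · intro i a p hp n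
    have hr : (mulOp (shiftFun (cInvFun c₀))).act (fun n => (c₀ (n + 1) : R) * r i (n + 1)) =
        shiftFun (r i) := by
      funext n
      rw [mulOp_act]
      exact Units.inv_mul_cancel_left _ _
    -- With `Δ^*(Λ r) = -Δ r`, the factor `(B Δ⁻¹)^*` produces `-∂r(n+1)` by `deriv_r`; the defect
    -- term accounts for the derivative of `c₀(n+1)`.
    have hr' : (delta.adj : FormalOp R).act (shiftFun (r i)) = -deltaFun (r i) := by
      funext n
      rw [adj_delta_act, Pi.neg_apply, deltaFun, shiftFun, shiftFun, sub_add_cancel, neg_sub]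
    have e : (todaB (T₂ c₀ * L₁ * T₂InvMinus c₀) (T₂ c₀ * L₂ * T₂InvPlus c₀) a p).adj =
        mulOp (shiftFun (cFun c₀)) * ((mTodaB L₁ L₂ a p * deltaInvMinus).adj * delta.adj +
          mulOp (shiftFun (todaDefect L₁ L₂ a p))) * mulOp (shiftFun (cInvFun c₀)) := by
      rw [hL.todaB_T₂, adj_mul, adj_mul, adj_add, adj_mulOp, adj_mulOp, adj_mulOp, adj_mul delta]
      exact (hv.mul_assoc (((hC a p).adj.mul isLaurent_delta.adj).add (hg a p))).symm
    have hX := (hC a p).adj.mul isLaurent_delta.adj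
    rw [e, (hv.mul (hX.add (hg a p))).act_mul hu, hr, hv.act_mul (hX.add (hg a p)), mulOp_act,
      hX.add_act (hg a p), (hC a p).adj.act_mul isLaurent_delta.adj, hr', act_neg, Pi.add_apply,
      Pi.neg_apply, ← hL.deriv_r i a p hp, mulOp_act, Derivation.leibniz, hS.deriv_c hL a p hp,
      shiftFun, shiftFun, shiftFun, cFun, smul_eq_mul, smul_eq_mul]
    ring

end IsGBMT

end Miura
end MiuraToda

theorem mainTheorem7 {R : Type*} [CommRing R] [Algebra ℂ R]
    (D : Fin 2 → ℕ → Derivation ℂ R R) (M N m : ℕ) (hM : 1 ≤ M) (hN : 1 ≤ N)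
    (L₁ L₂ S₁ : MiuraToda.FormalOp R) (c₀ : ℤ → Rˣ) (q r : Fin m → ℤ → R)
    (hL : MiuraToda.IsGBMT D M N L₁ L₂ q r)
    (hS : MiuraToda.IsWaveOp D L₁ L₂ S₁ c₀) :
    MiuraToda.IsGBT D M N
      (MiuraToda.T₁ c₀ * L₁ * MiuraToda.T₁Inv c₀)
      (MiuraToda.T₁ c₀ * L₂ * MiuraToda.T₁Inv c₀)
      (fun i n => ((c₀ n)⁻¹ : Rˣ) * q i n)
      (fun i n => -(MiuraToda.deltaFun (r i) n * c₀ n)) ∧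
    MiuraToda.IsGBT D M N
      (MiuraToda.T₂ c₀ * L₁ * MiuraToda.T₂InvMinus c₀)
      (MiuraToda.T₂ c₀ * L₂ * MiuraToda.T₂InvPlus c₀)
      (fun i n => ((c₀ (n + 1))⁻¹ : Rˣ) * MiuraToda.deltaFun (q i) n)
      (fun i n => c₀ (n + 1) * r i (n + 1)) :=
  ⟨hL.isGBT_T₁ hS, hL.isGBT_T₂ hS⟩
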